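/- Let $S=(a,b)$ and $K=(c,d)$ be nonempty bounded open intervals of $\mathbb{R}$ and let $h>0$. For $y>0$ let $P_y(x)=\frac1\pi\frac{y}{x^2+y^2}$ and $Q_y(x)=\frac1\pi\frac{x}{x^2+y^2}$ be the Poisson and conjugate Poisson kernels, let $\star$ denote convolution on $\mathbb{R}$, and let $\widetilde{u}$ denote the extension of $u$ by zero to $\mathbb{R}$. Let $b_2: L^2(S,\mathbb{R}^2)\to L^2(K)$ be the bounded operator $$b_2[\mathbf{m}](x) = -\partial_y\left(Q_y\star\widetilde{m_1}+P_y\star\widetilde{m_2}\right)(x)\Big|_{y=h},\qquad x\in K,\ \mathbf{m}=(m_1,m_2),$$ and let $b_2^*: L^2(K)\to L^2(S,\mathbb{R}^2)$ be its Hilbert space adjoint. Let $W_0^{1,2}(K)$ be the space of real functions $\phi\in L^2(K)$ whose distributional derivative $\phi'$ belongs to $L^2(K)$ and whose continuous representative on $[c,d]$ vanishes at $c$ and $d$, with the norm $\|\phi\|_{W_0^{1,2}(K)}=\|\phi'\|_{L^2(K)}$. Then $b_2^*[W_0^{1,2}(K)]$ is dense in $L^2(S,\mathbb{R}^2)$.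 Consequently the problem of minimizing $\|b_2^*[\phi]-\mathbf{e}\|_{L^2(S,\mathbb{R}^2)}$ over all $\phi\in W_0^{1,2}(K)$, without a constraint on $\|\phi\|_{W_0^{1,2}(K)}$, is ill-posed, in the following sense. 1. For every $\mathbf{e}\in L^2(S,\mathbb{R}^2)$ one has $\inf_{\phi\in W_0^{1,2}(K)}\|b_2^*[\phi]-\mathbf{e}\|_{L^2(S,\mathbb{R}^2)}=0$. 2. There exists $\mathbf{e}\in L^2(S,\mathbb{R}^2)$ with $\mathbf{e}\notin b_2^*[W_0^{1,2}(K)]$. 3. For every $\mathbf{e}\notin b_2^*[W_0^{1,2}(K)]$ the infimum is not attained, and every sequence $(\phi_n)$ in $W_0^{1,2}(K)$ with $\|b_2^*[\phi_n]-\mathbf{e}\|_{L^2(S,\mathbb{R}^2)}\to 0$ satisfies $\|\phi_n\|_{W_0^{1,2}(K)}\to\infty$. 4. For every $\mathbf{e}\in L^2(S,\mathbb{R}^2)$ there is a sequence $(\phi_n)$ in $W_0^{1,2}(K)$ with $\|b_2^*[\phi_n]-\mathbf{e}\|_{L^2(S,\mathbb{R}^2)}\to 0$ and $\|\phi_n\|_{W_0^{1,2}(K)}\to\infty$.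 -/

import Mathlib

open MeasureTheory Set Filter Topology

namespace MomentRecovery

/-- `L²(I, E)` for the open interval `I = (a, b)`, as a Hilbert space of classes of functions. -/
abbrev L2 (a b : ℝ) (E : Type) [NormedAddCommGroup E] : Type :=
  Lp E 2 (volume.restrict (Ioo a b))

/-- The Euclidean plane, in which the magnetizations take their values. -/
abbrev Plane : Type := EuclideanSpace ℝ (Fin 2)

/-- The Poisson kernel `P_y(x) = (1/π) y / (x² + y²)` of the upper half-plane. -/
noncomputable def poisson (y x : ℝ) : ℝ := 1 / Real.pi * (y / (x ^ 2 + y ^ 2))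

/-- The conjugate Poisson kernel `Q_y(x) = (1/π) x / (x² + y²)`. -/
noncomputable def conjPoisson (y x : ℝ) : ℝ := 1 / Real.pi * (x / (x ^ 2 + y ^ 2))

/-- Convolution on the line, `(k ⋆ u)(x) = ∫ k(x - t) u(t) dt`. -/
noncomputable def conv (k u : ℝ → ℝ) (x : ℝ) : ℝ := ∫ t, k (x - t) * u t

/-- Extension by zero to the line of the `i`-th component of a field on `(a, b)`. -/
noncomputable def extComp {a b : ℝ} (m : L2 a b Plane) (i : Fin 2) : ℝ → ℝ :=
  (Ioo a b).indicator fun t => m t i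

/-- The function `x ↦ -∂_y (Q_y ⋆ m̃₁ + P_y ⋆ m̃₂)(x)` at height `y = h`. -/
noncomputable def fieldFun {a b : ℝ} (h : ℝ) (m : L2 a b Plane) (x : ℝ) : ℝ :=
  -deriv (fun y => conv (conjPoisson y) (extComp m 0) x + conv (poisson y) (extComp m 1) x) h

/-! Facts needed to see that `fieldFun` defines a bounded operator. -/

noncomputable def dPoisson (y x : ℝ) : ℝ := 1 / Real.pi * ((x ^ 2 - y ^ 2) / (x ^ 2 + y ^ 2) ^ 2)

noncomputable def dConj (y x : ℝ) : ℝ := 1 / Real.pi * (-(2 * x * y) / (x ^ 2 + y ^ 2) ^ 2)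

lemma one_div_pi_le_one : 1 / Real.pi ≤ 1 := by
  rw [div_le_one Real.pi_pos]
  linarith [Real.pi_gt_three]

lemma hasDerivAt_poisson {y : ℝ} (hy : 0 < y) (x : ℝ) :
    HasDerivAt (fun y => poisson y x) (dPoisson y x) y := by
  have hne : x ^ 2 + y ^ 2 ≠ 0 := by positivity
  have h1 : HasDerivAt (fun y : ℝ => x ^ 2 + y ^ 2) (2 * y) y := by
    simpa using (hasDerivAt_pow 2 y).const_add (x ^ 2)
  have h2 := ((hasDerivAt_id y).div h1 hne).const_mul (1 / Real.pi)
  refine h2.congr_deriv ?_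
  simp only [dPoisson, id]
  congr 2
  ring

lemma hasDerivAt_conjPoisson {y : ℝ} (hy : 0 < y) (x : ℝ) :
    HasDerivAt (fun y => conjPoisson y x) (dConj y x) y := by
  have hne : x ^ 2 + y ^ 2 ≠ 0 := by positivity
  have h1 : HasDerivAt (fun y : ℝ => x ^ 2 + y ^ 2) (2 * y) y := by
    simpa using (hasDerivAt_pow 2 y).const_add (x ^ 2)
  have h2 := ((hasDerivAt_const y x).div h1 hne).const_mul (1 / Real.pi)
  refine h2.congr_deriv ?_
  simp only [dConj]
  congr 2
  ring

lemma abs_kernel_le {z y w : ℝ} (hy : 0 < y) (x : ℝ) (hz : |z| ≤ x ^ 2 + y ^ 2)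
    (hw : w = 1 / Real.pi * (z / (x ^ 2 + y ^ 2) ^ 2)) : |w| ≤ 1 / y ^ 2 := by
  have hp : 0 < x ^ 2 + y ^ 2 := by positivity
  have h1 : |z / (x ^ 2 + y ^ 2) ^ 2| ≤ 1 / y ^ 2 := by
    rw [abs_div, abs_of_pos (pow_pos hp 2), div_le_div_iff₀ (pow_pos hp 2) (by positivity)]
    nlinarith [mul_le_mul hz (show y ^ 2 ≤ x ^ 2 + y ^ 2 by nlinarith [sq_nonneg x])
      (by positivity) hp.le]
  have h0 : 0 ≤ 1 / Real.pi := by positivity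
  rw [hw, abs_mul, abs_of_nonneg h0]
  calc _ ≤ 1 * (1 / y ^ 2) := mul_le_mul one_div_pi_le_one h1 (abs_nonneg _) zero_le_one
    _ = _ := one_mul _

lemma abs_dPoisson_le {y : ℝ} (hy : 0 < y) (x : ℝ) : |dPoisson y x| ≤ 1 / y ^ 2 :=
  abs_kernel_le hy x (by rw [abs_le]; constructor <;> nlinarith [sq_nonneg x, sq_nonneg y]) rfl

lemma abs_dConj_le {y : ℝ} (hy : 0 < y) (x : ℝ) : |dConj y x| ≤ 1 / y ^ 2 :=
  abs_kernel_le hy x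
    (by rw [abs_le]; constructor <;> nlinarith [sq_nonneg (x - y), sq_nonneg (x + y)]) rfl

lemma abs_poisson_le {y : ℝ} (hy : 0 < y) (x : ℝ) : |poisson y x| ≤ 1 / y ^ 2 * y := by
  have hp : 0 < x ^ 2 + y ^ 2 := by positivity
  have h0 : 0 ≤ 1 / Real.pi := by positivity
  have h1 : y / (x ^ 2 + y ^ 2) ≤ 1 / y ^ 2 * y := by
    rw [one_div_mul_eq_div]
    exact div_le_div_of_nonneg_left hy.le (by positivity) (by nlinarith [sq_nonneg x])
  rw [poisson, abs_mul, abs_of_nonneg h0, abs_of_nonneg (by positivity : 0 ≤ y / (x ^ 2 + y ^ 2))]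
  calc _ ≤ 1 * (1 / y ^ 2 * y) := mul_le_mul one_div_pi_le_one h1 (by positivity) zero_le_one
    _ = _ := one_mul _

lemma abs_conjPoisson_le {y : ℝ} (hy : 0 < y) (x : ℝ) : |conjPoisson y x| ≤ 1 / y ^ 2 * y := by
  have hp : 0 < x ^ 2 + y ^ 2 := by positivity
  have h0 : 0 ≤ 1 / Real.pi := by positivity
  have h1 : |x / (x ^ 2 + y ^ 2)| ≤ 1 / y ^ 2 * y := by
    rw [one_div_mul_eq_div, abs_div, abs_of_pos hp, div_le_div_iff₀ hp (by positivity)]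
    have : |x| * y ≤ x ^ 2 + y ^ 2 := by nlinarith [sq_nonneg (|x| - y), sq_abs x, abs_nonneg x]
    nlinarith
  rw [conjPoisson, abs_mul, abs_of_nonneg h0]
  calc _ ≤ 1 * (1 / y ^ 2 * y) := mul_le_mul one_div_pi_le_one h1 (by positivity) zero_le_one
    _ = _ := one_mul _

lemma hasDerivAt_conv {k k' : ℝ → ℝ → ℝ} (hkm : ∀ y, Measurable (k y))
    (hk'm : ∀ y, Measurable (k' y))
    (hd : ∀ y, 0 < y → ∀ x, HasDerivAt (fun y => k y x) (k' y x) y)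
    (hb : ∀ y, 0 < y → ∀ x, |k y x| ≤ 1 / y ^ 2 * y)
    (hb' : ∀ y, 0 < y → ∀ x, |k' y x| ≤ 1 / y ^ 2)
    {u : ℝ → ℝ} (hu : Integrable u) {h : ℝ} (hh : 0 < h) (x : ℝ) :
    HasDerivAt (fun y => conv (k y) u x) (conv (k' h) u x) h := by
  have hs : Ioi (h / 2) ∈ 𝓝 h := Ioi_mem_nhds (by linarith)
  refine (hasDerivAt_integral_of_dominated_loc_of_deriv_le (μ := volume)
    (F := fun y t => k y (x - t) * u t) (F' := fun y t => k' y (x - t) * u t)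
    (bound := fun t => 1 / (h / 2) ^ 2 * ‖u t‖) hs ?_ ?_ ?_ ?_ ?_ ?_).2
  · exact Eventually.of_forall fun y =>
      (((hkm y).comp (measurable_const.sub measurable_id)).aestronglyMeasurable).mul
        hu.aestronglyMeasurable
  · exact hu.bdd_mul ((hkm h).comp (measurable_const.sub measurable_id)).aestronglyMeasurable
      (Eventually.of_forall fun t => hb h hh (x - t))
  · exact ((hk'm h).comp (measurable_const.sub measurable_id)).aestronglyMeasurable.mul
      hu.aestronglyMeasurable
  · refine Eventually.of_forall fun t y hy => ?_
    have hy' : h / 2 < y := hy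
    have h0 : 0 < h / 2 := by linarith
    rw [norm_mul]
    refine mul_le_mul_of_nonneg_right ((hb' y (by linarith) _).trans ?_) (norm_nonneg _)
    exact one_div_le_one_div_of_le (by positivity) (by gcongr)
  · exact hu.norm.const_mul _
  · refine Eventually.of_forall fun t y hy => ?_
    have hy' : h / 2 < y := hy
    exact (hd y (by linarith) (x - t)).mul_const (u t)

lemma memLp_comp {a b : ℝ} (m : L2 a b Plane) (i : Fin 2) :
    MemLp (fun t => m t i) 2 (volume.restrict (Ioo a b)) :=
  (Lp.memLp m).of_le
    ((EuclideanSpace.proj (𝕜 := ℝ) i).continuous.comp_aestronglyMeasurable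
      (Lp.aestronglyMeasurable m))
    (Eventually.of_forall fun t => PiLp.norm_apply_le (m t) i)

lemma integrable_extComp {a b : ℝ} (m : L2 a b Plane) (i : Fin 2) :
    Integrable (extComp m i) :=
  (integrable_indicator_iff measurableSet_Ioo).2 ((memLp_comp m i).integrable one_le_two)

lemma measurable_dPoisson (y : ℝ) : Measurable (dPoisson y) := by
  unfold dPoisson; fun_prop

lemma measurable_dConj (y : ℝ) : Measurable (dConj y) := by
  unfold dConj; fun_prop

lemma fieldFun_eq {a b h : ℝ} (hh : 0 < h) (m : L2 a b Plane) (x : ℝ) :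
    fieldFun h m x = -(conv (dConj h) (extComp m 0) x + conv (dPoisson h) (extComp m 1) x) := by
  rw [fieldFun]
  congr 1
  refine HasDerivAt.deriv (HasDerivAt.add ?_ ?_)
  · exact hasDerivAt_conv (fun y => by unfold conjPoisson; fun_prop) measurable_dConj
      (fun y hy x => hasDerivAt_conjPoisson hy x) (fun y hy x => abs_conjPoisson_le hy x)
      (fun y hy x => abs_dConj_le hy x) (integrable_extComp m 0) hh x
  · exact hasDerivAt_conv (fun y => by unfold poisson; fun_prop) measurable_dPoisson
      (fun y hy x => hasDerivAt_poisson hy x) (fun y hy x => abs_poisson_le hy x)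
      (fun y hy x => abs_dPoisson_le hy x) (integrable_extComp m 1) hh x

lemma integrable_conv {k u : ℝ → ℝ} {C : ℝ} (hk : Measurable k) (hb : ∀ x, |k x| ≤ C)
    (hu : Integrable u) (x : ℝ) : Integrable fun t => k (x - t) * u t :=
  hu.bdd_mul (hk.comp (measurable_const.sub measurable_id)).aestronglyMeasurable
    (Eventually.of_forall fun t => hb (x - t))

lemma abs_conv_le {k u : ℝ → ℝ} {C : ℝ} (hb : ∀ x, |k x| ≤ C)
    (hu : Integrable u) (x : ℝ) : |conv k u x| ≤ C * ∫ t, |u t| := by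
  rw [← integral_const_mul, ← Real.norm_eq_abs, conv]
  refine norm_integral_le_of_norm_le (hu.norm.const_mul C) (Eventually.of_forall fun t => ?_)
  rw [norm_mul]
  exact mul_le_mul_of_nonneg_right (hb _) (norm_nonneg _)

lemma aesm_conv {k u : ℝ → ℝ} (hk : Measurable k) (hu : Integrable u) (μ : Measure ℝ) :
    AEStronglyMeasurable (conv k u) μ := by
  have h1 : conv k u = conv k (hu.aestronglyMeasurable.mk u) := by
    funext x
    refine integral_congr_ae ?_
    filter_upwards [hu.aestronglyMeasurable.ae_eq_mk] with t ht
    rw [ht]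
  rw [h1]
  have h2 : StronglyMeasurable (Function.uncurry fun x t : ℝ =>
      k (x - t) * hu.aestronglyMeasurable.mk u t) := by
    refine Measurable.stronglyMeasurable ?_
    exact (hk.comp (measurable_fst.sub measurable_snd)).mul
      (hu.aestronglyMeasurable.stronglyMeasurable_mk.measurable.comp measurable_snd)
  exact h2.integral_prod_right.aestronglyMeasurable

lemma integral_abs_extComp_le {a b : ℝ} (m : L2 a b Plane) (i : Fin 2) :
    ∫ t, |extComp m i t| ≤ ‖m‖ * (volume.restrict (Ioo a b)).real univ ^ (1 / 2 : ℝ) := by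
  have h1 : ∫ t, |extComp m i t| = ∫ t in Ioo a b, |m t i| := by
    rw [← integral_indicator measurableSet_Ioo]
    congr 1
    funext t
    by_cases ht : t ∈ Ioo a b <;> simp [extComp, ht]
  have hi : Integrable (fun t => m t) (volume.restrict (Ioo a b)) :=
    (Lp.memLp m).integrable one_le_two
  have h2 : ∫ t in Ioo a b, |m t i| ≤ ∫ t in Ioo a b, ‖m t‖ :=
    integral_mono ((memLp_comp m i).integrable one_le_two).norm hi.norm
      fun t => PiLp.norm_apply_le (m t) i
  have h3 := eLpNorm_le_eLpNorm_mul_rpow_measure_univ (p := 1) (q := 2) one_le_two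
    (Lp.aestronglyMeasurable m)
  have h4 := ENNReal.toReal_mono (ENNReal.mul_ne_top (Lp.eLpNorm_ne_top m)
    (ENNReal.rpow_ne_top_of_nonneg (by norm_num) (measure_ne_top _ _))) h3
  rw [h1]
  refine h2.trans ?_
  rw [integral_norm_eq_lintegral_enorm hi.aestronglyMeasurable, ← eLpNorm_one_eq_lintegral_enorm]
  refine h4.trans_eq ?_
  rw [ENNReal.toReal_mul, ← Lp.norm_def, ← ENNReal.toReal_rpow, measureReal_def]
  norm_num

lemma abs_fieldFun_le {a b h : ℝ} (hh : 0 < h) (m : L2 a b Plane) (x : ℝ) :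
    |fieldFun h m x| ≤
      2 * (1 / h ^ 2) * (volume.restrict (Ioo a b)).real univ ^ (1 / 2 : ℝ) * ‖m‖ := by
  have h0 : 0 ≤ 1 / h ^ 2 := by positivity
  have h1 := (abs_conv_le (abs_dConj_le hh) (integrable_extComp m 0) x).trans
    (mul_le_mul_of_nonneg_left (integral_abs_extComp_le m 0) h0)
  have h2 := (abs_conv_le (abs_dPoisson_le hh) (integrable_extComp m 1) x).trans
    (mul_le_mul_of_nonneg_left (integral_abs_extComp_le m 1) h0)
  rw [fieldFun_eq hh, abs_neg]
  refine (abs_add_le _ _).trans ((add_le_add h1 h2).trans_eq ?_)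
  ring

lemma memLp_fieldFun {a b h : ℝ} (c d : ℝ) (hh : 0 < h) (m : L2 a b Plane) :
    MemLp (fieldFun h m) 2 (volume.restrict (Ioo c d)) := by
  refine MemLp.of_bound ?_ _ (Eventually.of_forall fun x => abs_fieldFun_le hh m x)
  have : fieldFun h m = fun x =>
      -(conv (dConj h) (extComp m 0) x + conv (dPoisson h) (extComp m 1) x) :=
    funext fun x => fieldFun_eq hh m x
  rw [this]
  exact ((aesm_conv (measurable_dConj h) (integrable_extComp m 0) _).add
    (aesm_conv (measurable_dPoisson h) (integrable_extComp m 1) _)).neg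

lemma extComp_add {a b : ℝ} (m n : L2 a b Plane) (i : Fin 2) :
    extComp (m + n) i =ᵐ[volume] fun t => extComp m i t + extComp n i t := by
  have h := (ae_restrict_iff' measurableSet_Ioo).1 (Lp.coeFn_add m n)
  filter_upwards [h] with t ht
  by_cases hI : t ∈ Ioo a b
  · simp only [extComp, indicator_of_mem hI, ht hI, Pi.add_apply, PiLp.add_apply]
  · simp [extComp, hI]

lemma extComp_smul {a b : ℝ} (r : ℝ) (m : L2 a b Plane) (i : Fin 2) :
    extComp (r • m) i =ᵐ[volume] fun t => r * extComp m i t := by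
  have h := (ae_restrict_iff' measurableSet_Ioo).1 (Lp.coeFn_smul r m)
  filter_upwards [h] with t ht
  by_cases hI : t ∈ Ioo a b
  · simp only [extComp, indicator_of_mem hI, ht hI, Pi.smul_apply, PiLp.smul_apply, smul_eq_mul]
  · simp [extComp, hI]

lemma conv_extComp_add {a b : ℝ} {k : ℝ → ℝ} {C : ℝ} (hk : Measurable k) (hb : ∀ x, |k x| ≤ C)
    (m n : L2 a b Plane) (i : Fin 2) (x : ℝ) :
    conv k (extComp (m + n) i) x = conv k (extComp m i) x + conv k (extComp n i) x := by
  rw [conv, conv, conv, ← integral_add (integrable_conv hk hb (integrable_extComp m i) x)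
    (integrable_conv hk hb (integrable_extComp n i) x)]
  refine integral_congr_ae ?_
  filter_upwards [extComp_add m n i] with t ht
  rw [ht, mul_add]

lemma conv_extComp_smul {a b : ℝ} (k : ℝ → ℝ) (r : ℝ)
    (m : L2 a b Plane) (i : Fin 2) (x : ℝ) :
    conv k (extComp (r • m) i) x = r * conv k (extComp m i) x := by
  rw [conv, conv, ← integral_const_mul]
  refine integral_congr_ae ?_
  filter_upwards [extComp_smul r m i] with t ht
  rw [ht]
  ring

/-- The magnetization-to-field operator `b₂ : L²(S, ℝ²) → L²(K)`, with `S = (a, b)`,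
`K = (c, d)`: `b₂[m] = -∂_y (Q_y ⋆ m̃₁ + P_y ⋆ m̃₂)` restricted to `K × {h}`. -/
noncomputable def b2 (a b c d : ℝ) {h : ℝ} (hh : 0 < h) : L2 a b Plane →L[ℝ] L2 c d ℝ :=
  LinearMap.mkContinuous
    { toFun := fun m => (memLp_fieldFun c d hh m).toLp (fieldFun h m)
      map_add' := fun m n => by
        rw [← MemLp.toLp_add]
        refine MemLp.toLp_congr _ _ (Eventually.of_forall fun x => ?_)
        simp only [Pi.add_apply]
        rw [fieldFun_eq hh, fieldFun_eq hh, fieldFun_eq hh,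
          conv_extComp_add (measurable_dConj h) (abs_dConj_le hh),
          conv_extComp_add (measurable_dPoisson h) (abs_dPoisson_le hh)]
        ring
      map_smul' := fun r m => by
        rw [RingHom.id_apply, ← MemLp.toLp_const_smul]
        refine MemLp.toLp_congr _ _ (Eventually.of_forall fun x => ?_)
        simp only [Pi.smul_apply, smul_eq_mul]
        rw [fieldFun_eq hh, fieldFun_eq hh, conv_extComp_smul, conv_extComp_smul]
        ring }
    ((volume.restrict (Ioo c d)).real univ ^ (2 : ENNReal).toReal⁻¹ *
      (2 * (1 / h ^ 2) * (volume.restrict (Ioo a b)).real univ ^ (1 / 2 : ℝ)))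
    (fun m => by
      refine (Lp.norm_le_of_ae_bound
        (C := 2 * (1 / h ^ 2) * (volume.restrict (Ioo a b)).real univ ^ (1 / 2 : ℝ) * ‖m‖)
        (by positivity) ?_).trans_eq ?_
      · filter_upwards [MemLp.coeFn_toLp (memLp_fieldFun c d hh m)] with x hx
        simp only [LinearMap.coe_mk, AddHom.coe_mk]
        rw [hx]
        exact abs_fieldFun_le hh m x
      · simp only [measureUnivNNReal, ENNReal.coe_toNNReal_eq_toReal, measureReal_def]
        ring)

/-- The Hilbert space adjoint `b₂* : L²(K) → L²(S, ℝ²)`. -/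
noncomputable def b2Star (a b c d : ℝ) {h : ℝ} (hh : 0 < h) : L2 c d ℝ →L[ℝ] L2 a b Plane :=
  ContinuousLinearMap.adjoint (b2 a b c d hh)

/-- `g` is the distributional derivative of `f` on the interval `(c, d)`. -/
def HasWeakDeriv {c d : ℝ} (f g : L2 c d ℝ) : Prop :=
  ∀ η : ℝ → ℝ, ContDiff ℝ (⊤ : ℕ∞) η → HasCompactSupport η → tsupport η ⊆ Ioo c d →
    ∫ x in Ioo c d, f x * deriv η x = -∫ x in Ioo c d, g x * η x

/-- The Sobolev space `W^{1,2}((c, d))`. -/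
def W12 (c d : ℝ) : Set (L2 c d ℝ) := {f | ∃ g : L2 c d ℝ, HasWeakDeriv f g}

/-- The space `W_0^{1,2}((c, d))` of the functions in `W^{1,2}((c, d))` that vanish at both
endpoints; the values there are those of the representative that is continuous on `[c, d]`. -/
def W12Zero (c d : ℝ) : Set (L2 c d ℝ) :=
  {f | f ∈ W12 c d ∧ ∃ u : ℝ → ℝ, ContinuousOn u (Icc c d) ∧
    f =ᵐ[volume.restrict (Ioo c d)] u ∧ u c = 0 ∧ u d = 0}

open Classical in
/-- The distributional derivative of a function in `W^{1,2}((c, d))`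
(and `0` for other functions). -/
noncomputable def weakDeriv {c d : ℝ} (f : L2 c d ℝ) : L2 c d ℝ :=
  if hf : ∃ g : L2 c d ℝ, HasWeakDeriv f g then hf.choose else 0

/-- The norm `‖φ‖ = ‖φ'‖_{L²(K)}` of `W_0^{1,2}(K)`. -/
noncomputable def normW {c d : ℝ} (f : L2 c d ℝ) : ℝ := ‖weakDeriv f‖

end MomentRecovery

namespace MomentRecovery

/-! The heart of the matter is that `b2` is injective. By `two_pi_mul_kernel_eq` the field is, up to
a constant factor, `C ν (x + ih) + C ρ (x - ih)`, where `C` is `cauchySq`, `ν = m₂ - i m₁` and `ρ =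
m₂ + i m₁`. If this sum vanishes on an interval, then `C ν (z + ih)`, holomorphic for `Im z > -h`,
and `-C ρ (z - ih)`, holomorphic for `Im z < h`, agree on their common strip. They glue to a bounded
entire function, constant by Liouville, and zero because it decays along the imaginary axis
(`cauchySq_eq_zero_of_add_eq_zero`). Expanding `C ν` at infinity shows that all moments of `ν`
vanish, so `ν = 0` by Weierstrass approximation. As `m` is real, `ν` alone determines it.

Density follows by duality: if `m` is orthogonal to the image, then `b2 m` is orthogonal to
`W12Zero`, which contains the test functions; hence `b2 m = 0` and `m = 0`.

The adjoint is not onto, even from all of `L²(K)`: `b2` is bounded for the `L¹` norm, so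
surjectivity and the uniform boundedness principle would bound in `L²` every `L¹`-bounded family of
fields. Concentrating step fields contradict this.

Divergence is weak compactness. `W12Zero` is the image of the zero-mean functions under the bounded
operator `primitive`. If `normW` stayed bounded infinitely often along a minimizing sequence, a weak
limit of the derivatives would produce a preimage of `e`. Data inside the image are approximated by
data outside the range, whose minimizing sequences diverge. -/

/-! ### Cauchy-type integrals and the Liouville argument -/

/-- The Cauchy-type integral `w ↦ ∫ ν(t) (w - t)⁻² dt`. -/
noncomputable def cauchySq (ν : ℝ → ℂ) (w : ℂ) : ℂ := ∫ t : ℝ, ((w - t) ^ 2)⁻¹ * ν t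

lemma abs_im_le_norm_sub_ofReal (w : ℂ) (t : ℝ) : |w.im| ≤ ‖w - t‖ := by
  simpa using Complex.abs_im_le_norm (w - t)

lemma sub_ofReal_ne_zero {w : ℂ} (hw : w.im ≠ 0) (t : ℝ) : w - t ≠ 0 := by
  intro h
  exact hw (by simpa using congrArg Complex.im h)

lemma norm_inv_pow_sub_ofReal_le {w : ℂ} {δ : ℝ} (hδ : 0 < δ) (hw : δ ≤ |w.im|) (n : ℕ) (t : ℝ) :
    ‖((w - t) ^ n)⁻¹‖ ≤ (δ ^ n)⁻¹ := by
  rw [norm_inv, norm_pow]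
  exact inv_anti₀ (by positivity)
    (pow_le_pow_left₀ hδ.le (hw.trans (abs_im_le_norm_sub_ofReal w t)) n)

lemma measurable_inv_pow_sub_ofReal (w : ℂ) (n : ℕ) :
    Measurable fun t : ℝ => ((w - t) ^ n)⁻¹ := by
  fun_prop

lemma integrable_cauchySq {ν : ℝ → ℂ} (hν : Integrable ν) {w : ℂ} (hw : w.im ≠ 0) :
    Integrable fun t : ℝ => ((w - t) ^ 2)⁻¹ * ν t :=
  hν.bdd_mul (measurable_inv_pow_sub_ofReal w 2).aestronglyMeasurable
    (Eventually.of_forall fun t => norm_inv_pow_sub_ofReal_le (abs_pos.2 hw) le_rfl 2 t)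

lemma norm_cauchySq_le {ν : ℝ → ℂ} (hν : Integrable ν) {w : ℂ} {δ : ℝ} (hδ : 0 < δ)
    (hw : δ ≤ |w.im|) : ‖cauchySq ν w‖ ≤ (δ ^ 2)⁻¹ * ∫ t, ‖ν t‖ := by
  rw [← integral_const_mul, cauchySq]
  refine norm_integral_le_of_norm_le (hν.norm.const_mul _) (Eventually.of_forall fun t => ?_)
  rw [norm_mul]
  exact mul_le_mul_of_nonneg_right (norm_inv_pow_sub_ofReal_le hδ hw 2 t) (norm_nonneg _)

lemma differentiableAt_cauchySq {ν : ℝ → ℂ} (hν : Integrable ν) {w : ℂ} (hw : w.im ≠ 0) :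
    DifferentiableAt ℂ (cauchySq ν) w := by
  have hδ : 0 < |w.im| / 2 := by positivity
  -- Staying at half the height of `w` above or below the real axis gives one integrable bound for
  -- the differentiated kernel near `w`.
  set s : Set ℂ := {z | |w.im| / 2 < |z.im|} with hs_def
  have hs : s ∈ 𝓝 w := by
    refine IsOpen.mem_nhds (isOpen_lt continuous_const (by fun_prop)) ?_
    have := abs_pos.2 hw
    change |w.im| / 2 < |w.im|
    linarith
  refine (hasDerivAt_integral_of_dominated_loc_of_deriv_le (μ := volume)
    (F := fun (z : ℂ) (t : ℝ) => ((z - t) ^ 2)⁻¹ * ν t)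
    (F' := fun (z : ℂ) (t : ℝ) => -2 * ((z - t) ^ 3)⁻¹ * ν t)
    (bound := fun t => 2 * ((|w.im| / 2) ^ 3)⁻¹ * ‖ν t‖) hs ?_ ?_ ?_ ?_ ?_ ?_).2.differentiableAt
  · exact Eventually.of_forall fun z =>
      (measurable_inv_pow_sub_ofReal z 2).aestronglyMeasurable.mul hν.aestronglyMeasurable
  · exact integrable_cauchySq hν hw
  · exact ((measurable_inv_pow_sub_ofReal w 3).const_mul _).aestronglyMeasurable.mul
      hν.aestronglyMeasurable
  · refine Eventually.of_forall fun t z hz => ?_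
    rw [norm_mul, norm_mul]
    refine mul_le_mul_of_nonneg_right ?_ (norm_nonneg _)
    have := norm_inv_pow_sub_ofReal_le hδ (le_of_lt hz) 3 t
    have h2 : ‖(-2 : ℂ)‖ = 2 := by simp
    rw [h2]
    linarith
  · exact hν.norm.const_mul _
  · refine Eventually.of_forall fun t z hz => ?_
    have hz0 : z.im ≠ 0 := abs_pos.1 (hδ.trans hz)
    have hne := sub_ofReal_ne_zero hz0 t
    have h1 : HasDerivAt (fun z : ℂ => (z - t) ^ 2) (2 * (z - t)) z := by
      exact (((hasDerivAt_id z).sub_const (t : ℂ)).fun_pow 2).congr_deriv (by simp)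
    refine ((h1.inv (pow_ne_zero 2 hne)).mul_const (ν t)).congr_deriv ?_
    congr 1
    field_simp

/-- If the sum of two Cauchy-type integrals with singularities on the lines `Im z = ∓h` vanishes
on a real interval, then the first one vanishes above its line. -/
lemma cauchySq_eq_zero_of_add_eq_zero {ν ρ : ℝ → ℂ} (hν : Integrable ν) (hρ : Integrable ρ)
    {c d h : ℝ} (hcd : c < d) (hh : 0 < h)
    (hzero : ∀ x ∈ Ioo c d,
      cauchySq ν ((x : ℂ) + h * Complex.I) + cauchySq ρ ((x : ℂ) - h * Complex.I) = 0)
    {w : ℂ} (hw : 0 < w.im) : cauchySq ν w = 0 := by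
  set G : ℂ → ℂ := fun z => cauchySq ν (z + h * Complex.I) with hG
  set H : ℂ → ℂ := fun z => -cauchySq ρ (z - h * Complex.I) with hH
  have im_add : ∀ z : ℂ, (z + h * Complex.I).im = z.im + h := fun z => by simp
  have im_sub : ∀ z : ℂ, (z - h * Complex.I).im = z.im - h := fun z => by simp
  have hGd : ∀ z : ℂ, -h < z.im → DifferentiableAt ℂ G z := fun z hz => by
    have := differentiableAt_cauchySq hν (w := z + h * Complex.I)
      (by rw [im_add]; linarith)
    exact DifferentiableAt.comp (g := cauchySq ν) z this (differentiableAt_id.add_const _)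
  have hHd : ∀ z : ℂ, z.im < h → DifferentiableAt ℂ H z := fun z hz => by
    have := differentiableAt_cauchySq hρ (w := z - h * Complex.I)
      (by rw [im_sub]; linarith)
    exact (DifferentiableAt.comp (g := cauchySq ρ) z this (differentiableAt_id.sub_const _)).neg
  set U : Set ℂ := {z | -h < z.im} ∩ {z | z.im < h} with hU
  have hUo : IsOpen U :=
    (isOpen_lt continuous_const Complex.continuous_im).inter
      (isOpen_lt Complex.continuous_im continuous_const)
  have hUc : Convex ℝ U :=
    (convex_halfSpace_im_gt (-h)).inter (convex_halfSpace_im_lt h)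
  have hEq : EqOn G H U := by
    set x₀ : ℝ := (c + d) / 2 with hx₀
    have hGa : AnalyticOnNhd ℂ G U := DifferentiableOn.analyticOnNhd
      (fun z hz => (hGd z hz.1).differentiableWithinAt) hUo
    have hHa : AnalyticOnNhd ℂ H U := DifferentiableOn.analyticOnNhd
      (fun z hz => (hHd z hz.2).differentiableWithinAt) hUo
    -- Identity theorem: the real points near the midpoint of `(c, d)` accumulate there, and the
    -- strip is convex.
    refine hGa.eqOn_of_preconnected_of_frequently_eq hHa hUc.isPreconnected
      (z₀ := (x₀ : ℂ)) ⟨by simpa using hh, by simpa using hh⟩ ?_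
    have hmap : Tendsto (fun x : ℝ => (x : ℂ)) (𝓝[≠] x₀) (𝓝[≠] (x₀ : ℂ)) := by
      refine tendsto_nhdsWithin_of_tendsto_nhds_of_eventually_within _
        (Complex.continuous_ofReal.continuousAt.tendsto.mono_left nhdsWithin_le_nhds) ?_
      filter_upwards [self_mem_nhdsWithin] with x hx
      exact fun h => hx (Complex.ofReal_injective h)
    refine hmap.frequently (Eventually.frequently ?_)
    have : Ioo c d ∈ 𝓝[≠] x₀ :=
      nhdsWithin_le_nhds (Ioo_mem_nhds (by rw [hx₀]; linarith) (by rw [hx₀]; linarith))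
    filter_upwards [this] with x hx
    exact eq_neg_of_add_eq_zero_left (hzero x hx)
  classical
  set E : ℂ → ℂ := fun z => if 0 ≤ z.im then G z else H z with hE
  have hEG : ∀ z : ℂ, -h < z.im → E z = G z := fun z hz => by
    by_cases h0 : 0 ≤ z.im
    · simp [hE, h0]
    · simp only [hE, h0, if_false]
      exact (hEq ⟨hz, lt_trans (not_le.1 h0) hh⟩).symm
  have hEH : ∀ z : ℂ, z.im < h → E z = H z := fun z hz => by
    by_cases h0 : 0 ≤ z.im
    · simp only [hE, h0, if_true]
      exact hEq ⟨lt_of_lt_of_le (by linarith) h0, hz⟩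
    · simp [hE, h0]
  have hEd : Differentiable ℂ E := fun z => by
    by_cases h0 : -h < z.im
    · refine (hGd z h0).congr_of_eventuallyEq ?_
      filter_upwards [(isOpen_lt continuous_const Complex.continuous_im).mem_nhds h0] with y hy
      exact hEG y hy
    · have h1 : z.im < h := by linarith
      refine (hHd z h1).congr_of_eventuallyEq ?_
      filter_upwards [(isOpen_lt Complex.continuous_im continuous_const).mem_nhds h1] with y hy
      exact hEH y hy
  -- Because the gluing switches on the real axis, each Cauchy integral is only evaluated at
  -- distance at least `h` from its singular line.
  have hEb : Bornology.IsBounded (range E) := by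
    refine isBounded_iff_forall_norm_le.2
      ⟨(h ^ 2)⁻¹ * (∫ t, ‖ν t‖) + (h ^ 2)⁻¹ * ∫ t, ‖ρ t‖, ?_⟩
    rintro _ ⟨z, rfl⟩
    have hp : 0 ≤ (h ^ 2)⁻¹ * (∫ t, ‖ν t‖) := by positivity
    have hq : 0 ≤ (h ^ 2)⁻¹ * (∫ t, ‖ρ t‖) := by positivity
    by_cases h0 : 0 ≤ z.im
    · have := norm_cauchySq_le hν (w := z + h * Complex.I) hh
        (by rw [im_add, abs_of_nonneg (by linarith)]; linarith)
      simp only [hE, h0, if_true, hG]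
      linarith
    · have := norm_cauchySq_le hρ (w := z - h * Complex.I) hh
        (by rw [im_sub, abs_of_neg (by linarith)]; linarith)
      simp only [hE, h0, if_false, hH, norm_neg]
      linarith
  have hconst : ∀ z, E z = E 0 := fun z => hEd.apply_eq_apply_of_bounded hEb z 0
  -- The constant is found at `iy` with `y → ∞`, where the integral is `O(y⁻²)`.
  have hE0 : E 0 = 0 := by
    have ht : Tendsto (fun y : ℝ => (y ^ 2)⁻¹ * ∫ t, ‖ν t‖) atTop (𝓝 0) := by
      have := (tendsto_pow_atTop (α := ℝ) two_ne_zero).inv_tendsto_atTop.mul_const (∫ t, ‖ν t‖)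
      simpa using this
    have hle : ∀ᶠ y : ℝ in atTop, ‖E 0‖ ≤ (y ^ 2)⁻¹ * ∫ t, ‖ν t‖ := by
      filter_upwards [eventually_gt_atTop 0] with y hy
      rw [← hconst (y * Complex.I), hEG _ (by simp; linarith)]
      refine norm_cauchySq_le hν hy ?_
      rw [im_add, abs_of_nonneg (by simp; linarith)]
      simpa using hh.le
    exact norm_le_zero_iff.1 (ge_of_tendsto ht hle)
  have h1 := hEG (w - h * Complex.I) (by rw [im_sub]; linarith)
  rw [hconst, hE0] at h1
  simpa [hG] using h1.symm

/-! ### Vanishing moments and determinacy -/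

lemma hasSum_succ_mul_pow {z : ℂ} (hz : ‖z‖ < 1) :
    HasSum (fun n : ℕ => ((n : ℂ) + 1) * z ^ n) ((1 - z) ^ 2)⁻¹ := by
  have := hasSum_choose_mul_geometric_of_norm_lt_one 1 hz
  simpa using this

/-- A compactly supported density whose Cauchy-type integral vanishes in the upper half-plane
has vanishing moments. -/
lemma integral_pow_mul_eq_zero_of_cauchySq_eq_zero {ν : ℝ → ℂ} (hν : Integrable ν) {R : ℝ}
    (hR : 0 < R) (hsupp : ∀ t, R < |t| → ν t = 0)
    (hzero : ∀ w : ℂ, 0 < w.im → cauchySq ν w = 0) (n : ℕ) :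
    ∫ t : ℝ, (t : ℂ) ^ n * ν t = 0 := by
  -- `Φ` is `w² C ν (w)` in the coordinate `s = 1/w` at infinity. It is analytic at `0`, with Taylor
  -- coefficients `(n + 1)` times the moments of `ν`.
  set Φ : ℂ → ℂ := fun s => ∫ t : ℝ, ((1 - s * t) ^ 2)⁻¹ * ν t with hΦ
  set a : ℕ → ℂ := fun n => ((n : ℂ) + 1) * ∫ t : ℝ, (t : ℂ) ^ n * ν t with ha
  have hpow : ∀ (k : ℕ) (t : ℝ), ‖(t : ℂ) ^ k * ν t‖ ≤ R ^ k * ‖ν t‖ := fun k t => by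
    by_cases ht : R < |t|
    · simp [hsupp t ht]
    · rw [norm_mul, norm_pow, Complex.norm_real, Real.norm_eq_abs]
      gcongr
      exact not_lt.1 ht
  have hint : ∀ k : ℕ, Integrable fun t : ℝ => (t : ℂ) ^ k * ν t := fun k =>
    (hν.norm.const_mul (R ^ k)).mono'
      ((by fun_prop : Measurable fun t : ℝ => (t : ℂ) ^ k).aestronglyMeasurable.mul
        hν.aestronglyMeasurable) (Eventually.of_forall (hpow k))
  have hsum : ∀ s : ℂ, ‖s‖ < 1 / R → HasSum (fun k => s ^ k * a k) (Φ s) := fun s hs => by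
    have hsR : ‖s‖ * R < 1 := by rwa [lt_div_iff₀ hR] at hs
    have hF : ∀ k : ℕ, Integrable fun t : ℝ => ((k : ℂ) + 1) * s ^ k * ((t : ℂ) ^ k * ν t) :=
      fun k => (hint k).const_mul _
    have hS : Summable fun k : ℕ =>
        ∫ t : ℝ, ‖((k : ℂ) + 1) * s ^ k * ((t : ℂ) ^ k * ν t)‖ := by
      -- On the support `|t| ≤ R`, so termwise integration needs only `‖s‖ R < 1`.
      have hg : Summable fun k : ℕ => ((k : ℝ) + 1) * (‖s‖ * R) ^ k * ∫ t, ‖ν t‖ := by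
        refine Summable.mul_right _ ?_
        have := summable_choose_mul_geometric_of_norm_lt_one (R := ℝ) 1 (r := ‖s‖ * R)
          (by rw [Real.norm_of_nonneg (by positivity)]; exact hsR)
        simpa using this
      refine Summable.of_nonneg_of_le (fun k => by positivity) (fun k => ?_) hg
      rw [← integral_const_mul]
      refine integral_mono (hF k).norm (hν.norm.const_mul _) fun t => ?_
      have h1 : ‖((k : ℂ) + 1)‖ = (k : ℝ) + 1 := by
        rw [← Nat.cast_succ, Complex.norm_natCast]; simp
      simp only
      rw [norm_mul, norm_mul, norm_pow, h1, mul_pow]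
      calc _ ≤ ((k : ℝ) + 1) * ‖s‖ ^ k * (R ^ k * ‖ν t‖) := by gcongr; exact hpow k t
        _ = _ := by ring
    have h1 := hasSum_integral_of_summable_integral_norm hF hS
    have h2 : (∫ t : ℝ, ∑' k : ℕ, ((k : ℂ) + 1) * s ^ k * ((t : ℂ) ^ k * ν t)) = Φ s := by
      refine integral_congr_ae (Eventually.of_forall fun t => ?_)
      by_cases ht : R < |t|
      · simp [hsupp t ht]
      · have hst : ‖s * t‖ < 1 := by
          rw [norm_mul, Complex.norm_real, Real.norm_eq_abs]
          exact lt_of_le_of_lt (by gcongr; exact not_lt.1 ht) hsR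
        have := ((hasSum_succ_mul_pow hst).mul_right (ν t)).tsum_eq
        simp only
        rw [← this]
        congr 1
        funext k
        ring
    rw [h2] at h1
    have h3 : (fun k : ℕ => ∫ t : ℝ, ((k : ℂ) + 1) * s ^ k * ((t : ℂ) ^ k * ν t)) =
        fun k => s ^ k * a k := by
      funext k
      rw [integral_const_mul, ha]
      ring
    rwa [h3] at h1
  have hps : HasFPowerSeriesAt Φ (FormalMultilinearSeries.ofScalars ℂ a) 0 := by
    rw [hasFPowerSeriesAt_iff]
    filter_upwards [Metric.ball_mem_nhds (0 : ℂ) (show 0 < 1 / R by positivity)] with s hs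
    have := hsum s (by simpa using hs)
    simpa [FormalMultilinearSeries.coeff_ofScalars] using this
  -- The points `s = -iy` with `y > 0` small correspond to `w = i/y` in the upper half-plane, and
  -- they accumulate at `0`.
  have hfreq : ∃ᶠ s in 𝓝[≠] (0 : ℂ), Φ s = 0 := by
    have hmap : Tendsto (fun y : ℝ => -(y : ℂ) * Complex.I) (𝓝[>] 0) (𝓝[≠] (0 : ℂ)) := by
      refine tendsto_nhdsWithin_of_tendsto_nhds_of_eventually_within _ ?_ ?_
      · have : Continuous fun y : ℝ => -(y : ℂ) * Complex.I := by fun_prop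
        simpa using (this.tendsto 0).mono_left nhdsWithin_le_nhds
      · filter_upwards [self_mem_nhdsWithin] with y hy
        have : y ≠ 0 := ne_of_gt hy
        simpa using this
    refine hmap.frequently (Eventually.frequently ?_)
    filter_upwards [self_mem_nhdsWithin] with y hy
    have hy' : (0 : ℝ) < y := hy
    have hyC : (y : ℂ) ≠ 0 := Complex.ofReal_ne_zero.2 hy'.ne'
    have hw := hzero (((y⁻¹ : ℝ) : ℂ) * Complex.I) (by simpa using hy')
    have : Φ (-(y : ℂ) * Complex.I) =
        (((y⁻¹ : ℝ) : ℂ) * Complex.I) ^ 2 * cauchySq ν (((y⁻¹ : ℝ) : ℂ) * Complex.I) := by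
      rw [cauchySq, ← integral_const_mul]
      refine integral_congr_ae (Eventually.of_forall fun t => ?_)
      have hne := sub_ofReal_ne_zero (w := ((y⁻¹ : ℝ) : ℂ) * Complex.I)
        (by simpa using hy'.ne') t
      have hwne : ((y⁻¹ : ℝ) : ℂ) * Complex.I ≠ 0 := by simp [hy'.ne']
      have h1 : (1 : ℂ) - -(y : ℂ) * Complex.I * t =
          (((y⁻¹ : ℝ) : ℂ) * Complex.I - t) / (((y⁻¹ : ℝ) : ℂ) * Complex.I) := by
        rw [eq_div_iff hwne]
        push_cast
        field_simp
        linear_combination (t * y : ℂ) * Complex.I_sq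
      simp only
      rw [h1, div_pow, inv_div]
      ring
    rw [this, hw, mul_zero]
  have hev := hps.analyticAt.frequently_zero_iff_eventually_zero.1 hfreq
  have hp0 := hps.eq_zero_of_eventually hev
  have hc : a n = 0 := by
    have := congrArg (fun p => FormalMultilinearSeries.coeff p n) hp0
    rw [FormalMultilinearSeries.coeff_ofScalars] at this
    exact this.trans (by simp [FormalMultilinearSeries.coeff])
  rw [ha] at hc
  exact (mul_eq_zero.1 hc).resolve_left (by exact_mod_cast Nat.succ_ne_zero n)

open Polynomial in
/-- A compactly supported integrable function is determined by its moments. -/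
lemma ae_eq_zero_of_integral_pow_mul_eq_zero {ν : ℝ → ℂ} (hν : Integrable ν) {R : ℝ}
    (hsupp : ∀ t, R < |t| → ν t = 0) (hmom : ∀ n : ℕ, ∫ t : ℝ, (t : ℂ) ^ n * ν t = 0) :
    ν =ᵐ[volume] 0 := by
  have hcont : ∀ {g : ℝ → ℝ}, Continuous g → Integrable fun t => (g t : ℂ) * ν t := by
    intro g hg
    obtain ⟨C, hC⟩ := (isCompact_Icc (a := -R) (b := R)).exists_bound_of_continuousOn hg.continuousOn
    refine (hν.norm.const_mul C).mono' ((Complex.continuous_ofReal.comp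
      hg).aestronglyMeasurable.mul hν.aestronglyMeasurable) (Eventually.of_forall fun t => ?_)
    by_cases ht : R < |t|
    · simp [hsupp t ht]
    · rw [norm_mul, Complex.norm_real]
      exact mul_le_mul_of_nonneg_right (hC t (abs_le.1 (not_lt.1 ht))) (norm_nonneg _)
  have hpoly : ∀ p : ℝ[X], ∫ t : ℝ, ((p.eval t : ℝ) : ℂ) * ν t = 0 := by
    intro p
    induction p using Polynomial.induction_on' with
    | add p q hp hq =>
      simp only [eval_add, Complex.ofReal_add, add_mul]
      rw [integral_add (hcont p.continuous) (hcont q.continuous), hp, hq, add_zero]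
    | monomial n r =>
      simp only [eval_monomial, Complex.ofReal_mul, Complex.ofReal_pow, mul_assoc]
      rw [integral_const_mul, hmom, mul_zero]
  refine ae_eq_zero_of_integral_contDiff_smul_eq_zero hν.locallyIntegrable fun g hg _ => ?_
  simp only [Complex.real_smul]
  refine norm_le_zero_iff.1 (le_of_forall_pos_le_add fun ε hε => ?_)
  set M := ∫ t, ‖ν t‖ with hM
  have hM0 : 0 ≤ M := integral_nonneg fun _ => norm_nonneg _
  -- The `+ 1` keeps the tolerance meaningful when `M = 0`.
  obtain ⟨p, hp⟩ := exists_polynomial_near_of_continuousOn (-R) R g hg.continuous.continuousOn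
    (ε / (M + 1)) (by positivity)
  have h1 : ∫ t, (g t : ℂ) * ν t = ∫ t : ℝ, ((g t : ℂ) * ν t - ((p.eval t : ℝ) : ℂ) * ν t) := by
    rw [integral_sub (hcont hg.continuous) (hcont p.continuous), hpoly, sub_zero]
  rw [h1, zero_add]
  have h2 : ‖∫ t : ℝ, ((g t : ℂ) * ν t - ((p.eval t : ℝ) : ℂ) * ν t)‖ ≤ ε / (M + 1) * M := by
    rw [hM, ← integral_const_mul]
    refine norm_integral_le_of_norm_le (hν.norm.const_mul _) (Eventually.of_forall fun t => ?_)
    by_cases ht : R < |t|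
    · simp [hsupp t ht]
    · rw [← sub_mul, norm_mul, ← Complex.ofReal_sub, Complex.norm_real, Real.norm_eq_abs,
        abs_sub_comm]
      exact mul_le_mul_of_nonneg_right (hp t (abs_le.1 (not_lt.1 ht))).le (norm_nonneg _)
  refine h2.trans ?_
  rw [div_mul_eq_mul_div, div_le_iff₀ (by positivity)]
  nlinarith

/-! ### Injectivity of the field operator -/

/-- Partial fractions in `u`: both differentiated kernels are combinations of the conjugate double
poles at `∓ih`. Clearing denominators leaves an identity modulo `I² = -1`. -/
lemma two_pi_mul_kernel_eq {h : ℝ} (hh : 0 < h) (u p q : ℝ) :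
    ((2 * Real.pi * (dConj h u * p + dPoisson h u * q) : ℝ) : ℂ) =
      (((u : ℂ) + h * Complex.I) ^ 2)⁻¹ * (q - Complex.I * p) +
        (((u : ℂ) - h * Complex.I) ^ 2)⁻¹ * (q + Complex.I * p) := by
  have h1 : (u : ℂ) + h * Complex.I ≠ 0 := fun H => hh.ne' (by simpa using congrArg Complex.im H)
  have h2 : (u : ℂ) - h * Complex.I ≠ 0 := fun H => hh.ne' (by simpa using congrArg Complex.im H)
  have h3 : (u : ℂ) ^ 2 + (h : ℂ) ^ 2 = ((u : ℂ) + h * Complex.I) * ((u : ℂ) - h * Complex.I) := by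
    linear_combination ((h : ℂ) ^ 2) * Complex.I_sq
  have hpi : (Real.pi : ℂ) ≠ 0 := Complex.ofReal_ne_zero.2 Real.pi_ne_zero
  rw [dConj, dPoisson]
  push_cast
  rw [h3]
  field_simp
  linear_combination (-2 * (h : ℂ) ^ 2 * q - 4 * u * h * p) * Complex.I_sq

lemma two_pi_mul_fieldFun_eq {a b h : ℝ} (hh : 0 < h) (m : L2 a b Plane) (x : ℝ) :
    ((-(2 * Real.pi * fieldFun h m x) : ℝ) : ℂ) =
      cauchySq (fun t => (extComp m 1 t : ℂ) - Complex.I * extComp m 0 t)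
        ((x : ℂ) + h * Complex.I) +
      cauchySq (fun t => (extComp m 1 t : ℂ) + Complex.I * extComp m 0 t)
        ((x : ℂ) - h * Complex.I) := by
  have i0 := (integrable_extComp m 0).ofReal (𝕜 := ℂ)
  have i1 := (integrable_extComp m 1).ofReal (𝕜 := ℂ)
  set ν : ℝ → ℂ := fun t => (extComp m 1 t : ℂ) - Complex.I * extComp m 0 t with hν_def
  set ρ : ℝ → ℂ := fun t => (extComp m 1 t : ℂ) + Complex.I * extComp m 0 t with hρ_def
  have hν : Integrable ν := i1.sub (i0.const_mul Complex.I)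
  have hρ : Integrable ρ := i1.add (i0.const_mul Complex.I)
  rw [fieldFun_eq hh, cauchySq, cauchySq, ← integral_add
    (integrable_cauchySq hν (by simp [hh.ne'])) (integrable_cauchySq hρ (by simp [hh.ne'])),
    conv, conv, ← integral_add
    (integrable_conv (measurable_dConj h) (abs_dConj_le hh) (integrable_extComp m 0) x)
    (integrable_conv (measurable_dPoisson h) (abs_dPoisson_le hh) (integrable_extComp m 1) x),
    mul_neg, neg_neg, ← integral_const_mul, ← integral_complex_ofReal]
  refine integral_congr_ae (Eventually.of_forall fun t => ?_)
  have := two_pi_mul_kernel_eq hh (x - t) (extComp m 0 t) (extComp m 1 t)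
  simp only
  rw [this]
  push_cast
  congr 4 <;> ring

lemma ext_of_extComp_ae_eq_zero {a b : ℝ} {m : L2 a b Plane}
    (h : ∀ i, extComp m i =ᵐ[volume] 0) : m = 0 := by
  refine Lp.ext ?_
  have h0 := (ae_restrict_iff' measurableSet_Ioo).2
    ((h 0).mono fun t ht (hI : t ∈ Ioo a b) => show m t 0 = 0 by simpa [extComp, hI] using ht)
  have h1 := (ae_restrict_iff' measurableSet_Ioo).2
    ((h 1).mono fun t ht (hI : t ∈ Ioo a b) => show m t 1 = 0 by simpa [extComp, hI] using ht)
  filter_upwards [h0, h1, Lp.coeFn_zero Plane 2 (volume.restrict (Ioo a b))] with t ht0 ht1 hz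
  rw [hz]
  ext i
  fin_cases i
  · simpa using ht0
  · simpa using ht1

lemma b2_apply_ae {a b h : ℝ} (c d : ℝ) (hh : 0 < h) (m : L2 a b Plane) :
    b2 a b c d hh m =ᵐ[volume.restrict (Ioo c d)] fieldFun h m :=
  MemLp.coeFn_toLp (memLp_fieldFun c d hh m)

/-- A magnetization is determined by its field on an interval at a positive height. -/
lemma eq_zero_of_fieldFun_ae_eq_zero {a b c d h : ℝ} (hcd : c < d) (hh : 0 < h)
    {m : L2 a b Plane} (hm : fieldFun h m =ᵐ[volume.restrict (Ioo c d)] 0) : m = 0 := by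
  have i0 := (integrable_extComp m 0).ofReal (𝕜 := ℂ)
  have i1 := (integrable_extComp m 1).ofReal (𝕜 := ℂ)
  set ν : ℝ → ℂ := fun t => (extComp m 1 t : ℂ) - Complex.I * extComp m 0 t with hν_def
  set ρ : ℝ → ℂ := fun t => (extComp m 1 t : ℂ) + Complex.I * extComp m 0 t with hρ_def
  have hν : Integrable ν := i1.sub (i0.const_mul Complex.I)
  have hρ : Integrable ρ := i1.add (i0.const_mul Complex.I)
  have hzero : EqOn (fun x : ℝ => cauchySq ν ((x : ℂ) + h * Complex.I) +
      cauchySq ρ ((x : ℂ) - h * Complex.I)) 0 (Ioo c d) := by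
    -- Both Cauchy integrals are continuous in `x`, which turns vanishing almost everywhere into
    -- vanishing everywhere on `(c, d)`.
    refine Measure.eqOn_open_of_ae_eq (μ := volume) ?_ isOpen_Ioo
      (Continuous.continuousOn ?_) continuousOn_const
    · filter_upwards [hm] with x hx
      rw [← two_pi_mul_fieldFun_eq hh m x, hx]
      simp
    · refine continuous_iff_continuousAt.2 fun x => ContinuousAt.add ?_ ?_
      · exact ContinuousAt.comp (g := cauchySq ν)
          (differentiableAt_cauchySq hν (by simp [hh.ne'])).continuousAt
          (Continuous.continuousAt (by fun_prop))
      · exact ContinuousAt.comp (g := cauchySq ρ)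
          (differentiableAt_cauchySq hρ (by simp [hh.ne'])).continuousAt
          (Continuous.continuousAt (by fun_prop))
  have hC : ∀ w : ℂ, 0 < w.im → cauchySq ν w = 0 := fun w hw =>
    cauchySq_eq_zero_of_add_eq_zero hν hρ hcd hh (fun x hx => hzero hx) hw
  have hR : 0 < max |a| |b| + 1 := by positivity
  have hsupp : ∀ t, max |a| |b| + 1 < |t| → ν t = 0 := fun t ht => by
    have hI : t ∉ Ioo a b := fun hI => by
      have h1 := abs_le_max_abs_abs hI.1.le hI.2.le
      linarith
    simp [hν_def, extComp, hI]
  have h0 := ae_eq_zero_of_integral_pow_mul_eq_zero hν hsupp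
    (integral_pow_mul_eq_zero_of_cauchySq_eq_zero hν hR hsupp hC)
  -- The components are real, so they are, up to sign, the imaginary and real parts of `ν`; no
  -- separate argument for `ρ` is needed.
  refine ext_of_extComp_ae_eq_zero (Fin.forall_fin_two.2 ⟨?_, ?_⟩)
  · filter_upwards [h0] with t ht
    simpa [hν_def] using congrArg Complex.im ht
  · filter_upwards [h0] with t ht
    simpa [hν_def] using congrArg Complex.re ht

/-! ### Failure of surjectivity of the adjoint -/

/-- The field of a magnetization is controlled by the `L¹` norms of its components. -/
lemma norm_b2_le {a b c d h : ℝ} (hh : 0 < h) (m : L2 a b Plane) :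
    ‖b2 a b c d hh m‖ ≤ (volume.restrict (Ioo c d)).real univ ^ (1 / 2 : ℝ) *
      (1 / h ^ 2 * ((∫ t, |extComp m 0 t|) + ∫ t, |extComp m 1 t|)) := by
  have hnn : 0 ≤ 1 / h ^ 2 * ((∫ t, |extComp m 0 t|) + ∫ t, |extComp m 1 t|) :=
    mul_nonneg (by positivity) (add_nonneg (integral_nonneg fun _ => abs_nonneg _)
      (integral_nonneg fun _ => abs_nonneg _))
  refine (Lp.norm_le_of_ae_bound hnn ?_).trans_eq ?_
  · filter_upwards [b2_apply_ae c d hh m] with x hx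
    rw [hx, fieldFun_eq hh, norm_neg, mul_add]
    exact (norm_add_le _ _).trans
      (add_le_add (abs_conv_le (abs_dConj_le hh) (integrable_extComp m 0) x)
        (abs_conv_le (abs_dPoisson_le hh) (integrable_extComp m 1) x))
  · simp [measureUnivNNReal, ENNReal.coe_toNNReal_eq_toReal, measureReal_def]

/-- The constant field `v e₁` on `(a, a + δ)`, where `e₁` is the first coordinate vector. -/
noncomputable def stepField (a b δ v : ℝ) : L2 a b Plane :=
  indicatorConstLp 2 (measurableSet_Ioo (a := a) (b := a + δ)) (measure_ne_top _ _)
    (EuclideanSpace.single 0 v)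

lemma extComp_stepField {a b δ v : ℝ} (hδb : a + δ ≤ b) (i : Fin 2) :
    extComp (stepField a b δ v) i =ᵐ[volume]
      (Ioo a (a + δ)).indicator fun _ => (EuclideanSpace.single 0 v : Plane) i := by
  have h := (ae_restrict_iff' measurableSet_Ioo).1
    (indicatorConstLp_coeFn (p := 2) (hs := measurableSet_Ioo (a := a) (b := a + δ))
      (hμs := measure_ne_top (volume.restrict (Ioo a b)) _)
      (c := (EuclideanSpace.single 0 v : Plane)))
  filter_upwards [h] with t ht
  by_cases hI : t ∈ Ioo a b
  · rw [extComp, indicator_of_mem hI, stepField, ht hI]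
    by_cases hJ : t ∈ Ioo a (a + δ) <;> simp [hJ]
  · have hJ : t ∉ Ioo a (a + δ) := fun hJ => hI ⟨hJ.1, hJ.2.trans_le hδb⟩
    rw [extComp, indicator_of_notMem hI, indicator_of_notMem hJ]

/-- For `v = δ⁻¹` the first component has `L¹` norm `1`, whereas `norm_stepField` gives the `L²`
norm `δ^(-1/2)`. This gap is what defeats surjectivity. -/
lemma integral_abs_extComp_stepField {a b δ v : ℝ} (hδ : 0 ≤ δ) (hδb : a + δ ≤ b) (i : Fin 2) :
    ∫ t, |extComp (stepField a b δ v) i t| = δ * |(EuclideanSpace.single 0 v : Plane) i| := by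
  have : (fun t => |extComp (stepField a b δ v) i t|) =ᵐ[volume]
      (Ioo a (a + δ)).indicator fun _ => |(EuclideanSpace.single 0 v : Plane) i| := by
    filter_upwards [extComp_stepField hδb i] with t ht
    rw [ht]
    by_cases hJ : t ∈ Ioo a (a + δ) <;> simp [hJ]
  rw [integral_congr_ae this, integral_indicator measurableSet_Ioo, setIntegral_const]
  simp [hδ]

lemma norm_stepField {a b δ v : ℝ} (hδ : 0 ≤ δ) (hδb : a + δ ≤ b) :
    ‖stepField a b δ v‖ = |v| * Real.sqrt δ := by
  have hsub : Ioo a (a + δ) ∩ Ioo a b = Ioo a (a + δ) :=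
    inter_eq_left.2 fun t ht => ⟨ht.1, ht.2.trans_le hδb⟩
  rw [stepField, norm_indicatorConstLp (by norm_num) (by norm_num), measureReal_def,
    Measure.restrict_apply measurableSet_Ioo, hsub, Real.sqrt_eq_rpow]
  simp [hδ]

/-- The adjoint operator is not surjective. -/
lemma exists_notMem_range_b2Star {a b : ℝ} (c d : ℝ) {h : ℝ} (hab : a < b) (hh : 0 < h) :
    ∃ e : L2 a b Plane, ∀ φ, b2Star a b c d hh φ ≠ e := by
  by_contra! hsurj
  set δ : ℕ → ℝ := fun n => (b - a) / (n + 1) with hδ_def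
  have hba : 0 < b - a := by linarith
  have hδ : ∀ n, 0 < δ n := fun n => by positivity
  have hδb : ∀ n, a + δ n ≤ b := fun n => by
    have : δ n ≤ b - a := div_le_self hba.le (by linarith [(Nat.cast_nonneg n : (0 : ℝ) ≤ n)])
    linarith
  set m : ℕ → L2 a b Plane := fun n => stepField a b (δ n) (δ n)⁻¹ with hm_def
  obtain ⟨C, hC⟩ : ∃ C, ∀ n, ‖b2 a b c d hh (m n)‖ ≤ C := by
    refine ⟨(volume.restrict (Ioo c d)).real univ ^ (1 / 2 : ℝ) * (1 / h ^ 2 * 1), fun n => ?_⟩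
    refine (norm_b2_le hh (m n)).trans_eq ?_
    rw [hm_def, integral_abs_extComp_stepField (hδ n).le (hδb n),
      integral_abs_extComp_stepField (hδ n).le (hδb n)]
    simp [abs_of_pos (hδ n), (hδ n).ne']
  -- If `e = b2Star φ`, then `⟪m n, e⟫ = ⟪b2 (m n), φ⟫` is at most `C ‖φ‖`. Surjectivity thus makes
  -- the functionals pointwise bounded, hence bounded in norm.
  obtain ⟨C', hC'⟩ := banach_steinhaus (𝕜 := ℝ) (𝕜₂ := ℝ) (g := fun n => innerSL ℝ (m n))
    (fun e => by
      obtain ⟨φ, rfl⟩ := hsurj e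
      refine ⟨C * ‖φ‖, fun n => ?_⟩
      rw [innerSL_apply_apply, b2Star, ContinuousLinearMap.adjoint_inner_right]
      exact (norm_inner_le_norm _ _).trans (mul_le_mul_of_nonneg_right (hC n) (norm_nonneg _)))
  -- Here `‖m n‖² = (δ n)⁻¹ = (n + 1) / (b - a)`.
  have hbd : ∀ n : ℕ, ((n : ℝ) + 1) ≤ C' ^ 2 * (b - a) := fun n => by
    have h1 := hC' n
    rw [innerSL_apply_norm, hm_def, norm_stepField (hδ n).le (hδb n)] at h1
    have h2 : |(δ n)⁻¹| * Real.sqrt (δ n) = Real.sqrt ((δ n)⁻¹) := by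
      rw [abs_of_pos (inv_pos.2 (hδ n)), Real.sqrt_inv]
      have := Real.mul_self_sqrt (hδ n).le
      have h0 := Real.sqrt_pos.2 (hδ n)
      field_simp
      rw [sq, this, div_self (hδ n).ne']
    rw [h2] at h1
    have h3 : (δ n)⁻¹ ≤ C' ^ 2 := by
      rw [← Real.sq_sqrt (inv_pos.2 (hδ n)).le]
      exact pow_le_pow_left₀ (Real.sqrt_nonneg _) h1 2
    rw [hδ_def] at h3
    simp only [inv_div] at h3
    rwa [div_le_iff₀ hba] at h3
  obtain ⟨n, hn⟩ := exists_nat_gt (C' ^ 2 * (b - a))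
  linarith [hbd n]

/-! ### Primitives and the space `W12Zero` -/

lemma integrableOn_L2 {c d : ℝ} (f : L2 c d ℝ) : IntegrableOn f (Ioo c d) :=
  (Lp.memLp f).integrable one_le_two

lemma intervalIntegrable_L2 {c d : ℝ} (hcd : c ≤ d) (f : L2 c d ℝ) :
    IntervalIntegrable f volume c d := by
  rw [intervalIntegrable_iff_integrableOn_Ioc_of_le hcd, integrableOn_Ioc_iff_integrableOn_Ioo]
  exact integrableOn_L2 f

lemma integrableOn_mul_of_hasCompactSupport {c d : ℝ} (f : L2 c d ℝ) {η : ℝ → ℝ}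
    (hη : Continuous η) (hs : HasCompactSupport η) :
    IntegrableOn (fun x => f x * η x) (Ioo c d) := by
  obtain ⟨C, hC⟩ := hs.exists_bound_of_continuous hη
  exact (integrableOn_L2 f).mul_bdd hη.aestronglyMeasurable (Eventually.of_forall hC)

/-- The value at `x` of the primitive of `g` that vanishes at `c`. -/
noncomputable def primFun {c d : ℝ} (g : L2 c d ℝ) (x : ℝ) : ℝ :=
  inner ℝ (indicatorConstLp 2 (measurableSet_Ioo (a := c) (b := x))
    (measure_ne_top (volume.restrict (Ioo c d)) _) (1 : ℝ)) g

/-- Links the inner-product form to the usual integral. The former gives linearity and the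
Cauchy–Schwarz bound at once, and makes `primFun g d = 0` a condition that survives weak limits. -/
lemma primFun_eq {c d : ℝ} (g : L2 c d ℝ) {x : ℝ} (hx : x ∈ Icc c d) :
    primFun g x = ∫ s in c..x, g s := by
  rw [primFun, L2.inner_indicatorConstLp_one, Measure.restrict_restrict measurableSet_Ioo,
    inter_eq_left.2 (Ioo_subset_Ioo_right hx.2), intervalIntegral.integral_of_le hx.1,
    integral_Ioc_eq_integral_Ioo]

lemma continuousOn_primFun {c d : ℝ} (hcd : c ≤ d) (g : L2 c d ℝ) :
    ContinuousOn (primFun g) (Icc c d) := by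
  have h := intervalIntegral.continuousOn_primitive_interval'
    (intervalIntegrable_L2 hcd g) left_mem_uIcc
  rw [uIcc_of_le hcd] at h
  exact h.congr fun x hx => primFun_eq g hx

lemma abs_primFun_le {c d : ℝ} (g : L2 c d ℝ) (x : ℝ) :
    |primFun g x| ≤ (volume.restrict (Ioo c d)).real univ ^ (1 / 2 : ℝ) * ‖g‖ := by
  refine (abs_real_inner_le_norm _ _).trans (mul_le_mul_of_nonneg_right ?_ (norm_nonneg _))
  rw [norm_indicatorConstLp (by norm_num) (by norm_num)]
  simp only [norm_one, one_mul, ENNReal.toReal_ofNat]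
  exact Real.rpow_le_rpow measureReal_nonneg (measureReal_mono (subset_univ _)) (by norm_num)

lemma memLp_primFun {c d : ℝ} (g : L2 c d ℝ) :
    MemLp (primFun g) 2 (volume.restrict (Ioo c d)) := by
  refine MemLp.of_bound ?_ _ (Eventually.of_forall fun x => abs_primFun_le g x)
  rcases le_or_gt c d with hcd | hcd
  · exact ((continuousOn_primFun hcd g).mono Ioo_subset_Icc_self).aestronglyMeasurable
      measurableSet_Ioo
  · rw [Ioo_eq_empty hcd.not_gt, Measure.restrict_empty]
    exact aestronglyMeasurable_zero_measure _

/-- The bounded operator on `L²(c, d)` that takes `g` to its primitive vanishing at `c`. -/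
noncomputable def primitive (c d : ℝ) : L2 c d ℝ →L[ℝ] L2 c d ℝ :=
  LinearMap.mkContinuous
    { toFun := fun g => (memLp_primFun g).toLp (primFun g)
      map_add' := fun f g => by
        rw [← MemLp.toLp_add]
        refine MemLp.toLp_congr _ _ (Eventually.of_forall fun x => ?_)
        exact inner_add_right _ _ _
      map_smul' := fun r g => by
        rw [RingHom.id_apply, ← MemLp.toLp_const_smul]
        refine MemLp.toLp_congr _ _ (Eventually.of_forall fun x => ?_)
        exact inner_smul_right_eq_smul _ _ _ }
    ((volume.restrict (Ioo c d)).real univ ^ (1 / 2 : ℝ) *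
      (volume.restrict (Ioo c d)).real univ ^ (1 / 2 : ℝ))
    (fun g => by
      refine (Lp.norm_le_of_ae_bound
        (C := (volume.restrict (Ioo c d)).real univ ^ (1 / 2 : ℝ) * ‖g‖)
        (by positivity) ?_).trans_eq ?_
      · filter_upwards [MemLp.coeFn_toLp (memLp_primFun g)] with x hx
        simp only [LinearMap.coe_mk, AddHom.coe_mk]
        rw [hx]
        exact abs_primFun_le g x
      · simp [measureUnivNNReal, ENNReal.coe_toNNReal_eq_toReal, measureReal_def, mul_assoc])

lemma primitive_ae_eq {c d : ℝ} (g : L2 c d ℝ) :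
    primitive c d g =ᵐ[volume.restrict (Ioo c d)] primFun g :=
  MemLp.coeFn_toLp (memLp_primFun g)

lemma eq_zero_of_tsupport_subset_Ioo {c d : ℝ} {η : ℝ → ℝ} (hη : tsupport η ⊆ Ioo c d) {x : ℝ}
    (hx : x ∉ Ioo c d) : η x = 0 :=
  image_eq_zero_of_notMem_tsupport fun h => hx (hη h)

/-- Integration by parts for absolutely continuous functions. The test function kills the boundary
terms, and the primitive is differentiable almost everywhere with derivative `g`. -/
lemma hasWeakDeriv_primitive {c d : ℝ} (hcd : c ≤ d) (g : L2 c d ℝ) :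
    HasWeakDeriv (primitive c d g) g := by
  intro η hη _ hs
  have hg := intervalIntegrable_L2 hcd g
  have hF := hg.absolutelyContinuousOnInterval_intervalIntegral (c := c) left_mem_uIcc
  have hηac : AbsolutelyContinuousOnInterval η c d :=
    ContDiffOn.absolutelyContinuousOnInterval (hη.of_le (by simp)).contDiffOn
  have hparts := hF.integral_mul_deriv_eq_deriv_mul hηac
  rw [eq_zero_of_tsupport_subset_Ioo hs (by simp : d ∉ Ioo c d),
    eq_zero_of_tsupport_subset_Ioo hs (by simp : c ∉ Ioo c d)] at hparts
  have h1 : ∫ x in Ioo c d, primitive c d g x * deriv η x =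
      ∫ x in c..d, (∫ s in c..x, g s) * deriv η x := by
    rw [intervalIntegral.integral_of_le hcd, integral_Ioc_eq_integral_Ioo]
    refine integral_congr_ae ?_
    filter_upwards [primitive_ae_eq g, ae_restrict_mem measurableSet_Ioo] with x hx hxI
    rw [hx, primFun_eq g (Ioo_subset_Icc_self hxI)]
  have h2 : ∫ x in Ioo c d, g x * η x =
      ∫ x in c..d, deriv (fun y => ∫ s in c..y, g s) x * η x := by
    rw [intervalIntegral.integral_of_le hcd, integral_Ioc_eq_integral_Ioo]
    refine integral_congr_ae ?_
    filter_upwards [ae_restrict_of_ae hg.ae_hasDerivAt_integral,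
      ae_restrict_mem measurableSet_Ioo] with x hx hxI
    rw [(hx (by rw [uIcc_of_le hcd]; exact Ioo_subset_Icc_self hxI) c left_mem_uIcc).deriv]
  rw [h1, h2, hparts]
  simp

lemma exists_Icc_of_isCompact_subset_Ioo {c d : ℝ} {s : Set ℝ} (hs : IsCompact s)
    (hne : s.Nonempty) (hsub : s ⊆ Ioo c d) :
    ∃ c' d', c < c' ∧ d' < d ∧ s ⊆ Icc c' d' :=
  ⟨sInf s, sSup s, (hsub (hs.sInf_mem hne)).1, (hsub (hs.sSup_mem hne)).2,
    fun _ hx => ⟨csInf_le hs.bddBelow hx, le_csSup hs.bddAbove hx⟩⟩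

/-- A test function on `(c, d)` with zero integral is the derivative of a test function. -/
lemma exists_test_primitive {c d : ℝ} {p : ℝ → ℝ} (hp : ContDiff ℝ (⊤ : ℕ∞) p) {s : Set ℝ}
    (hs : IsCompact s) (hne : s.Nonempty) (hsub : s ⊆ Ioo c d) (hps : ∀ x ∉ s, p x = 0)
    (hint : ∫ x, p x = 0) :
    ∃ η : ℝ → ℝ, ContDiff ℝ (⊤ : ℕ∞) η ∧ HasCompactSupport η ∧ tsupport η ⊆ Ioo c d ∧
      deriv η = p := by
  obtain ⟨c', d', hc, hd, hsI⟩ := exists_Icc_of_isCompact_subset_Ioo hs hne hsub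
  set η : ℝ → ℝ := fun x => ∫ t in c'..x, p t with hη_def
  have hder : ∀ x, HasDerivAt η (p x) x := fun x =>
    intervalIntegral.integral_hasDerivAt_right (hp.continuous.intervalIntegrable _ _)
      (hp.continuous.stronglyMeasurableAtFilter _ _) hp.continuous.continuousAt
  have hderiv : deriv η = p := funext fun x => (hder x).deriv
  have hcd' : c' ≤ d' := by
    obtain ⟨x, hx⟩ := hne
    exact (hsI hx).1.trans (hsI hx).2
  have hout : ∀ x, x ∉ Icc c' d' → p x = 0 := fun x hx => hps x fun h => hx (hsI h)
  -- Left of `c'` the integrand is zero; right of `d'` the integral is the total integral of `p`,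
  -- which is zero by hypothesis.
  have hη0 : ∀ x, x ∉ Icc c' d' → η x = 0 := fun x hx => by
    rcases lt_or_ge x c' with h | h
    · rw [hη_def]
      simp only
      rw [intervalIntegral.integral_symm, intervalIntegral.integral_of_le h.le,
        integral_Ioc_eq_integral_Ioo, setIntegral_eq_zero_of_forall_eq_zero, neg_zero]
      exact fun t ht => hout t fun hI => not_le.2 ht.2 hI.1
    · have hx' : d' < x := by
        by_contra hcon
        exact hx ⟨h, not_lt.1 hcon⟩
      rw [hη_def]
      simp only
      rw [intervalIntegral.integral_of_le h, ← integral_Icc_eq_integral_Ioc,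
        setIntegral_eq_integral_of_forall_compl_eq_zero, hint]
      exact fun t ht => hout t fun hI => ht ⟨hI.1, hI.2.trans hx'.le⟩
  refine ⟨η, ?_, HasCompactSupport.intro isCompact_Icc hη0, ?_, hderiv⟩
  · have h1 : ContDiff ℝ ((⊤ : ℕ∞) : WithTop ℕ∞) η ↔ _ := contDiff_infty_iff_deriv
    rw [h1, hderiv]
    exact ⟨fun x => (hder x).differentiableAt, hp⟩
  · refine (closure_minimal (fun x hx => ?_) isClosed_Icc).trans (Icc_subset_Ioo hc hd)
    by_contra hI
    exact hx (hη0 x hI)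

lemma setIntegral_Ioo_eq_integral {c d : ℝ} {ψ f : ℝ → ℝ} (hψ : tsupport ψ ⊆ Ioo c d) :
    ∫ x in Ioo c d, f x * ψ x = ∫ x, f x * ψ x :=
  setIntegral_eq_integral_of_forall_compl_eq_zero fun x hx => by
    rw [eq_zero_of_tsupport_subset_Ioo hψ hx, mul_zero]

/-- The du Bois-Reymond lemma: functions with the same weak derivative differ by a constant. -/
lemma HasWeakDeriv.exists_sub_ae_eq_const {c d : ℝ} (hcd : c < d) {f₁ f₂ g : L2 c d ℝ}
    (h₁ : HasWeakDeriv f₁ g) (h₂ : HasWeakDeriv f₂ g) :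
    ∃ κ : ℝ, ∀ᵐ x ∂volume.restrict (Ioo c d), f₁ x - f₂ x = κ := by
  have hr : 0 < (d - c) / 4 := by linarith
  -- The outer radius is a quarter of the length, so the closed support of the bump stays inside
  -- `(c, d)`.
  let θ : ContDiffBump ((c + d) / 2 : ℝ) := ⟨(d - c) / 8, (d - c) / 4, by linarith, by linarith⟩
  set τ : ℝ → ℝ := θ.normed volume with hτ_def
  have hτ : ContDiff ℝ (⊤ : ℕ∞) τ := θ.contDiff_normed
  have hτc : HasCompactSupport τ := θ.hasCompactSupport_normed
  have hτs : tsupport τ ⊆ Ioo c d := by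
    rw [hτ_def, θ.tsupport_normed_eq, Real.closedBall_eq_Icc]
    intro x hx
    have h1 : (c + d) / 2 - (d - c) / 4 ≤ x := hx.1
    have h2 : x ≤ (c + d) / 2 + (d - c) / 4 := hx.2
    constructor <;> linarith
  have hτi : ∫ x, τ x = 1 := θ.integral_normed
  have hmul : ∀ {η : ℝ → ℝ}, Continuous η → HasCompactSupport η →
      ∫ x in Ioo c d, (f₁ x - f₂ x) * η x =
        (∫ x in Ioo c d, f₁ x * η x) - ∫ x in Ioo c d, f₂ x * η x := fun hη hs => by
    rw [← integral_sub (integrableOn_mul_of_hasCompactSupport f₁ hη hs)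
      (integrableOn_mul_of_hasCompactSupport f₂ hη hs)]
    simp only [sub_mul]
  set κ : ℝ := ∫ x in Ioo c d, (f₁ x - f₂ x) * τ x with hκ
  refine ⟨κ, ?_⟩
  have hfi : IntegrableOn (fun x => f₁ x - f₂ x) (Ioo c d) :=
    (integrableOn_L2 f₁).sub (integrableOn_L2 f₂)
  have hwi : IntegrableOn (fun x => f₁ x - f₂ x - κ) (Ioo c d) :=
    hfi.sub (integrableOn_const (by simp))
  rw [ae_restrict_iff' measurableSet_Ioo]
  have key := isOpen_Ioo.ae_eq_zero_of_integral_contDiff_smul_eq_zero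
    (μ := volume) hwi.locallyIntegrableOn ?_
  · filter_upwards [key] with x hx hxI
    exact sub_eq_zero.1 (hx hxI)
  intro ψ hψ hψc hψs
  -- Since `τ` has integral `1`, `ψ - (∫ ψ) τ` has mean zero and equals some `η'`. The weak
  -- derivatives being equal, `f₁ - f₂` annihilates `η'`; hence it acts on `ψ` as the constant `κ`.
  obtain ⟨η, hη, hηc, hηs, hηd⟩ := exists_test_primitive (c := c) (d := d)
    (p := fun x => ψ x - (∫ y, ψ y) * τ x) (hψ.sub (contDiff_const.mul hτ))
    (s := tsupport ψ ∪ tsupport τ) (hψc.isCompact.union hτc.isCompact)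
    ⟨(c + d) / 2, Or.inr (by
      rw [hτ_def, θ.tsupport_normed_eq]
      exact Metric.mem_closedBall_self hr.le)⟩
    (union_subset hψs hτs)
    (fun x hx => by
      simp only [mem_union, not_or] at hx
      simp [image_eq_zero_of_notMem_tsupport hx.1, image_eq_zero_of_notMem_tsupport hx.2])
    (by
      rw [integral_sub (hψ.continuous.integrable_of_hasCompactSupport hψc)
        ((hτ.continuous.integrable_of_hasCompactSupport hτc).const_mul _),
        integral_const_mul, hτi, mul_one, sub_self])
  have h0 : ∫ x in Ioo c d, (f₁ x - f₂ x) * deriv η x = 0 := by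
    rw [hmul (hη.continuous_deriv (by simp)) hηc.deriv, h₁ η hη hηc hηs, h₂ η hη hηc hηs, sub_self]
  have hbd : ∀ {ζ : ℝ → ℝ}, Continuous ζ → HasCompactSupport ζ →
      IntegrableOn (fun x => (f₁ x - f₂ x) * ζ x) (Ioo c d) := fun hζ hζc => by
    obtain ⟨C, hC⟩ := hζc.exists_bound_of_continuous hζ
    exact hfi.mul_bdd hζ.aestronglyMeasurable (Eventually.of_forall hC)
  have h1 : ∫ x in Ioo c d, (f₁ x - f₂ x) * deriv η x =
      (∫ x in Ioo c d, (f₁ x - f₂ x) * ψ x) - (∫ y, ψ y) * κ := by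
    rw [hηd, hκ, ← integral_const_mul, ← integral_sub (hbd hψ.continuous hψc)
      ((hbd hτ.continuous hτc).const_mul _)]
    refine integral_congr_ae (Eventually.of_forall fun x => ?_)
    simp only
    ring
  have h2 : ∫ x, ψ x • (f₁ x - f₂ x - κ) =
      (∫ x in Ioo c d, (f₁ x - f₂ x) * ψ x) - (∫ y, ψ y) * κ := by
    have h3 : ∫ y, ψ y = ∫ y in Ioo c d, ψ y :=
      (setIntegral_eq_integral_of_forall_compl_eq_zero fun x hx =>
        eq_zero_of_tsupport_subset_Ioo hψs hx).symm
    rw [h3, ← integral_mul_const, ← integral_sub (hbd hψ.continuous hψc)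
      ((hψ.continuous.integrable_of_hasCompactSupport hψc).integrableOn.mul_const κ)]
    rw [← setIntegral_eq_integral_of_forall_compl_eq_zero (s := Ioo c d) fun x hx => by
      rw [eq_zero_of_tsupport_subset_Ioo hψs hx, zero_smul]]
    refine integral_congr_ae (Eventually.of_forall fun x => ?_)
    simp only [smul_eq_mul]
    ring
  rw [h2, ← h1, h0]

/-- The primitive of a function with zero mean belongs to `W_0^{1,2}`. -/
lemma primitive_mem_W12Zero {c d : ℝ} (hcd : c ≤ d) {g : L2 c d ℝ} (hg : primFun g d = 0) :
    primitive c d g ∈ W12Zero c d :=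
  ⟨⟨g, hasWeakDeriv_primitive hcd g⟩, primFun g, continuousOn_primFun hcd g, primitive_ae_eq g,
    by rw [primFun_eq g (left_mem_Icc.2 hcd), intervalIntegral.integral_same], hg⟩

/-- A function in `W_0^{1,2}` is the primitive of its weak derivative, which has zero mean. -/
lemma eq_primitive_of_mem_W12Zero {c d : ℝ} (hcd : c < d) {f : L2 c d ℝ} (hf : f ∈ W12Zero c d) :
    primitive c d (weakDeriv f) = f ∧ primFun (weakDeriv f) d = 0 := by
  obtain ⟨hW, u, hu, hfu, huc, hud⟩ := hf
  -- Membership in `W12` rules out the default value `0`. Only the defining property of the chosen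
  -- derivative is used, not its uniqueness.
  have hweak : HasWeakDeriv f (weakDeriv f) := by
    have hW' : ∃ g : L2 c d ℝ, HasWeakDeriv f g := hW
    rw [weakDeriv, dif_pos hW']
    exact hW'.choose_spec
  set g := weakDeriv f with hg
  obtain ⟨κ, hκ⟩ := hweak.exists_sub_ae_eq_const hcd (hasWeakDeriv_primitive hcd.le g)
  -- Continuity carries the almost everywhere identity to the endpoints: at `c` it gives `κ = 0`,
  -- and then at `d` it gives zero mean.
  have hEq : EqOn (fun x => u x - primFun g x) (fun _ => κ) (Icc c d) := by
    refine Measure.eqOn_Icc_of_ae_eq volume hcd.ne ?_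
      (hu.sub (continuousOn_primFun hcd.le g)) continuousOn_const
    rw [← restrict_Ioo_eq_restrict_Icc]
    filter_upwards [hκ, hfu, primitive_ae_eq g] with x h1 h2 h3
    rw [← h1, h2, h3]
  have hc0 : primFun g c = 0 := by
    rw [primFun_eq g (left_mem_Icc.2 hcd.le), intervalIntegral.integral_same]
  have hκ0 : κ = 0 := by
    have := hEq (left_mem_Icc.2 hcd.le)
    simp only [huc, hc0, sub_zero] at this
    exact this.symm
  have hd0 := hEq (right_mem_Icc.2 hcd.le)
  simp only [hud, hκ0] at hd0
  refine ⟨Lp.ext ?_, by linarith⟩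
  filter_upwards [hκ] with x hx
  linarith

/-- Test functions belong to `W_0^{1,2}`. -/
lemma exists_mem_W12Zero_of_contDiff {c d : ℝ} {η : ℝ → ℝ} (hη : ContDiff ℝ (⊤ : ℕ∞) η)
    (hηc : HasCompactSupport η) (hηs : tsupport η ⊆ Ioo c d) :
    ∃ f ∈ W12Zero c d, f =ᵐ[volume.restrict (Ioo c d)] η := by
  have hη' : Continuous (deriv η) := hη.continuous_deriv (by simp)
  have h1 : MemLp η 2 (volume.restrict (Ioo c d)) :=
    hη.continuous.memLp_of_hasCompactSupport hηc
  have h2 : MemLp (deriv η) 2 (volume.restrict (Ioo c d)) :=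
    hη'.memLp_of_hasCompactSupport hηc.deriv
  refine ⟨h1.toLp η, ⟨⟨h2.toLp (deriv η), fun ζ hζ hζc hζs => ?_⟩, η, hη.continuous.continuousOn,
    h1.coeFn_toLp, eq_zero_of_tsupport_subset_Ioo hηs (by simp),
    eq_zero_of_tsupport_subset_Ioo hηs (by simp)⟩, h1.coeFn_toLp⟩
  have hζ' : Continuous (deriv ζ) := hζ.continuous_deriv (by simp)
  have e1 : ∫ x in Ioo c d, h1.toLp η x * deriv ζ x = ∫ x, η x * deriv ζ x := by
    rw [← setIntegral_Ioo_eq_integral (tsupport_deriv_subset.trans hζs)]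
    exact integral_congr_ae (by filter_upwards [h1.coeFn_toLp] with x hx; rw [hx])
  have e2 : ∫ x in Ioo c d, h2.toLp (deriv η) x * ζ x = ∫ x, deriv η x * ζ x := by
    rw [← setIntegral_Ioo_eq_integral hζs]
    exact integral_congr_ae (by filter_upwards [h2.coeFn_toLp] with x hx; rw [hx])
  rw [e1, e2]
  exact integral_mul_deriv_eq_deriv_mul_of_integrable
    (fun x _ => (hη.differentiable (by simp) x).hasDerivAt)
    (fun x _ => (hζ.differentiable (by simp) x).hasDerivAt)
    ((hη.continuous.mul hζ').integrable_of_hasCompactSupport hηc.mul_right)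
    ((hη'.mul hζ.continuous).integrable_of_hasCompactSupport hηc.deriv.mul_right)
    ((hη.continuous.mul hζ.continuous).integrable_of_hasCompactSupport hηc.mul_right)

/-! ### Weak compactness and the subspace structure -/

/-- A bounded sequence in a real Hilbert space converges weakly along every ultrafilter. -/
lemma exists_weak_limit_ultrafilter {ι H : Type*} [NormedAddCommGroup H] [InnerProductSpace ℝ H]
    [CompleteSpace H] (g : ι → H) (M : ℝ) (U : Ultrafilter ι) (hU : ∀ᶠ n in U, ‖g n‖ ≤ M) :
    ∃ x, ∀ v, Tendsto (fun n => inner ℝ (g n) v) U (𝓝 (inner ℝ x v)) := by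
  set Γ : ι → WeakDual ℝ H := fun n =>
    StrongDual.toWeakDual (InnerProductSpace.toDual ℝ H (g n)) with hΓ
  -- Banach–Alaoglu on the dual; Riesz representation carries the limit back to `H`. An ultrafilter
  -- makes extracting a subsequence unnecessary.
  obtain ⟨l, -, hl⟩ := (WeakDual.isCompact_closedBall (𝕜 := ℝ) (E := H) 0 M).ultrafilter_le_nhds
    (U.map Γ) (by
      rw [le_principal_iff]
      change ∀ᶠ n in U, Γ n ∈ _
      filter_upwards [hU] with n hn
      simpa [hΓ] using hn)
  refine ⟨(InnerProductSpace.toDual ℝ H).symm (WeakDual.toStrongDual l), fun v => ?_⟩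
  have h1 : Tendsto (fun n => Γ n v) U (𝓝 (l v)) :=
    ((WeakBilin.eval_continuous _ v).tendsto l).comp hl
  rw [InnerProductSpace.toDual_symm_apply]
  exact h1

/-- The subspace `W_0^{1,2}(c, d)` of `L²(c, d)`, as the image of the functions with zero mean
under the primitive operator. -/
noncomputable def W12ZeroSubmodule (c d : ℝ) : Submodule ℝ (L2 c d ℝ) :=
  (LinearMap.ker (innerSL ℝ (indicatorConstLp 2 (measurableSet_Ioo (a := c) (b := d))
    (measure_ne_top (volume.restrict (Ioo c d)) _) (1 : ℝ))).toLinearMap).map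
    (primitive c d).toLinearMap

/-- Supplies the linear structure that the orthogonal-complement criterion for density requires. -/
lemma coe_W12ZeroSubmodule {c d : ℝ} (hcd : c < d) :
    (W12ZeroSubmodule c d : Set (L2 c d ℝ)) = W12Zero c d := by
  ext f
  constructor
  · rintro ⟨g, hg, rfl⟩
    exact primitive_mem_W12Zero hcd.le hg
  · intro hf
    obtain ⟨h1, h2⟩ := eq_primitive_of_mem_W12Zero hcd hf
    exact ⟨weakDeriv f, h2, h1⟩

/-- An `L²` function orthogonal to `W_0^{1,2}` vanishes. -/
lemma eq_zero_of_forall_W12Zero_inner_eq_zero {c d : ℝ} {f : L2 c d ℝ}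
    (hf : ∀ φ ∈ W12Zero c d, inner ℝ φ f = 0) : f = 0 := by
  refine Lp.ext ?_
  have h1 := isOpen_Ioo.ae_eq_zero_of_integral_contDiff_smul_eq_zero (μ := volume)
    (integrableOn_L2 f).locallyIntegrableOn fun η hη hηc hηs => by
      obtain ⟨φ, hφ, hφη⟩ := exists_mem_W12Zero_of_contDiff hη hηc hηs
      rw [← hf φ hφ, L2.inner_def, ← setIntegral_eq_integral_of_forall_compl_eq_zero
        (s := Ioo c d) fun x hx => by rw [eq_zero_of_tsupport_subset_Ioo hηs hx, zero_smul]]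
      refine integral_congr_ae ?_
      filter_upwards [hφη] with x hx
      simp [hx, mul_comm]
  filter_upwards [(ae_restrict_iff' measurableSet_Ioo).2 h1, Lp.coeFn_zero ℝ 2
    (volume.restrict (Ioo c d))] with x hx hz
  rw [hx, hz, Pi.zero_apply]

/-! ### Density and divergence of minimizing sequences -/

/-- Passing to adjoints, a vector orthogonal to the image has its field orthogonal to `W12Zero`;
that field is then zero, and injectivity finishes. -/
lemma dense_image_b2Star {a b c d h : ℝ} (hcd : c < d) (hh : 0 < h) :
    Dense (b2Star a b c d hh '' W12Zero c d) := by
  have h1 : b2Star a b c d hh '' W12Zero c d =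
      ((W12ZeroSubmodule c d).map (b2Star a b c d hh).toLinearMap : Set (L2 a b Plane)) := by
    rw [Submodule.map_coe, coe_W12ZeroSubmodule hcd]
    rfl
  rw [h1, Submodule.dense_iff_topologicalClosure_eq_top,
    Submodule.topologicalClosure_eq_top_iff, Submodule.eq_bot_iff]
  intro m hm
  have h2 : b2 a b c d hh m = 0 := by
    refine eq_zero_of_forall_W12Zero_inner_eq_zero fun φ hφ => ?_
    rw [← ContinuousLinearMap.adjoint_inner_left]
    exact (Submodule.mem_orthogonal _ _).1 hm _
      (Submodule.mem_map_of_mem (by rwa [← SetLike.mem_coe, coe_W12ZeroSubmodule hcd]))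
  refine eq_zero_of_fieldFun_ae_eq_zero hcd hh ((b2_apply_ae c d hh m).symm.trans ?_)
  rw [h2]
  exact Lp.coeFn_zero ℝ 2 _

/-- The image under `b₂*` of a ball of `W_0^{1,2}` is closed, in sequential form: minimizing
sequences for data outside the image diverge. -/
lemma tendsto_normW_atTop {a b c d h : ℝ} (hcd : c < d) (hh : 0 < h) {e : L2 a b Plane}
    (he : e ∉ b2Star a b c d hh '' W12Zero c d) {φ : ℕ → L2 c d ℝ} (hφ : ∀ n, φ n ∈ W12Zero c d)
    (hlim : Tendsto (fun n => ‖b2Star a b c d hh (φ n) - e‖) atTop (𝓝 0)) :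
    Tendsto (fun n => normW (φ n)) atTop atTop := by
  by_contra hcon
  rw [tendsto_atTop] at hcon
  push Not at hcon
  obtain ⟨M, hM⟩ := hcon
  have hne : (atTop ⊓ 𝓟 {n | normW (φ n) ≤ M}).NeBot :=
    frequently_mem_iff_neBot.1 (hM.mono fun n hn => hn.le)
  -- This ultrafilter refines `atTop` and lives on indices with bounded norm, so it sees both the
  -- convergence to `e` and the bound.
  set U : Ultrafilter ℕ := Ultrafilter.of (atTop ⊓ 𝓟 {n | normW (φ n) ≤ M})
  have hU := Ultrafilter.of_le (atTop ⊓ 𝓟 {n | normW (φ n) ≤ M})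
  have hUtop : (U : Filter ℕ) ≤ atTop := hU.trans inf_le_left
  have hUM : ∀ᶠ n in U, ‖weakDeriv (φ n)‖ ≤ M := (hU.trans inf_le_right) (mem_principal_self _)
  obtain ⟨g, hg⟩ := exists_weak_limit_ultrafilter (fun n => weakDeriv (φ n)) M U hUM
  refine he ⟨primitive c d g, primitive_mem_W12Zero hcd.le ?_, ?_⟩
  -- Zero mean is orthogonality to one fixed vector, so the weak limit inherits it.
  · have h1 := hg (indicatorConstLp 2 (measurableSet_Ioo (a := c) (b := d))
      (measure_ne_top (volume.restrict (Ioo c d)) _) (1 : ℝ))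
    rw [primFun, real_inner_comm]
    refine tendsto_nhds_unique h1 (tendsto_const_nhds.congr fun n => ?_)
    have h2 := (eq_primitive_of_mem_W12Zero hcd (hφ n)).2
    rw [primFun, real_inner_comm] at h2
    exact h2.symm
  · refine ext_inner_right ℝ fun v => ?_
    have h1 : Tendsto (fun n => inner ℝ (b2Star a b c d hh (φ n)) v) U (𝓝 (inner ℝ e v)) :=
      (((tendsto_iff_norm_sub_tendsto_zero.2 hlim).inner tendsto_const_nhds).mono_left hUtop)
    refine tendsto_nhds_unique ?_ h1
    -- Moving `b2Star` and `primitive` onto `v` reduces the claim to weak convergence of the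
    -- derivatives.
    have h2 := hg (ContinuousLinearMap.adjoint (primitive c d) (b2 a b c d hh v))
    rw [ContinuousLinearMap.adjoint_inner_right] at h2
    rw [b2Star, ContinuousLinearMap.adjoint_inner_left]
    refine h2.congr fun n => ?_
    rw [ContinuousLinearMap.adjoint_inner_right, (eq_primitive_of_mem_W12Zero hcd (hφ n)).1,
      ContinuousLinearMap.adjoint_inner_left]

lemma exists_seq_tendsto_b2Star {a b c d h : ℝ} (hcd : c < d) (hh : 0 < h) (e : L2 a b Plane) :
    ∃ φ : ℕ → L2 c d ℝ, (∀ n, φ n ∈ W12Zero c d) ∧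
      Tendsto (fun n => ‖b2Star a b c d hh (φ n) - e‖) atTop (𝓝 0) := by
  obtain ⟨x, hx, hxe⟩ := mem_closure_iff_seq_limit.1 (dense_image_b2Star (a := a) (b := b) hcd hh e)
  choose φ hφ hφx using hx
  refine ⟨φ, hφ, ?_⟩
  simp only [hφx]
  exact tendsto_iff_norm_sub_tendsto_zero.1 hxe

/-- Only data in the image need work. Adding `(n + 1)⁻¹ • e₁`, with `e₁` outside the range, leaves
the range by linearity, so a minimizing sequence for the perturbed data diverges. A late term of it
has error below `(n + 1)⁻¹` and norm at least `n`. -/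
lemma exists_seq_tendsto_b2Star_normW_atTop {a b c d h : ℝ} (hab : a < b) (hcd : c < d)
    (hh : 0 < h) (e : L2 a b Plane) :
    ∃ φ : ℕ → L2 c d ℝ, (∀ n, φ n ∈ W12Zero c d) ∧
      Tendsto (fun n => ‖b2Star a b c d hh (φ n) - e‖) atTop (𝓝 0) ∧
      Tendsto (fun n => normW (φ n)) atTop atTop := by
  by_cases he : e ∈ b2Star a b c d hh '' W12Zero c d
  swap
  · obtain ⟨φ, hφ, hlim⟩ := exists_seq_tendsto_b2Star hcd hh e
    exact ⟨φ, hφ, hlim, tendsto_normW_atTop hcd hh he hφ hlim⟩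
  obtain ⟨e₁, he₁⟩ := exists_notMem_range_b2Star c d hab hh
  obtain ⟨φ₀, -, rfl⟩ := he
  have hpert : ∀ n : ℕ, ∃ φ ∈ W12Zero c d,
      ‖b2Star a b c d hh φ - (b2Star a b c d hh φ₀ + ((n : ℝ) + 1)⁻¹ • e₁)‖ < ((n : ℝ) + 1)⁻¹ ∧
      (n : ℝ) ≤ normW φ := fun n => by
    have hpos : 0 < ((n : ℝ) + 1) := by positivity
    have hn : b2Star a b c d hh φ₀ + ((n : ℝ) + 1)⁻¹ • e₁ ∉ b2Star a b c d hh '' W12Zero c d := by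
      rintro ⟨ψ, -, hψ⟩
      refine he₁ (((n : ℝ) + 1) • (ψ - φ₀)) ?_
      rw [map_smul, map_sub, hψ, add_sub_cancel_left, smul_inv_smul₀ hpos.ne']
    obtain ⟨φ, hφ, hlim⟩ := exists_seq_tendsto_b2Star hcd hh
      (b2Star a b c d hh φ₀ + ((n : ℝ) + 1)⁻¹ • e₁)
    have htop := tendsto_normW_atTop hcd hh hn hφ hlim
    obtain ⟨k, hk1, hk2⟩ := ((hlim.eventually (gt_mem_nhds (inv_pos.2 hpos))).and
      (htop.eventually_ge_atTop (n : ℝ))).exists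
    exact ⟨φ k, hφ k, hk1, hk2⟩
  choose φ hφ h1 h2 using hpert
  refine ⟨φ, hφ, ?_, tendsto_atTop_mono h2 tendsto_natCast_atTop_atTop⟩
  have hinv : Tendsto (fun n : ℕ => ((n : ℝ) + 1)⁻¹ * (1 + ‖e₁‖)) atTop (𝓝 0) := by
    have := (tendsto_one_div_add_atTop_nhds_zero_nat (𝕜 := ℝ)).mul_const (1 + ‖e₁‖)
    simpa using this
  refine squeeze_zero (fun n => norm_nonneg _) (fun n => ?_) hinv
  have hpos : 0 < ((n : ℝ) + 1)⁻¹ := by positivity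
  calc ‖b2Star a b c d hh (φ n) - b2Star a b c d hh φ₀‖
      = ‖(b2Star a b c d hh (φ n) - (b2Star a b c d hh φ₀ + ((n : ℝ) + 1)⁻¹ • e₁)) +
          ((n : ℝ) + 1)⁻¹ • e₁‖ := by congr 1; abel
    _ ≤ _ := norm_add_le _ _
    _ ≤ ((n : ℝ) + 1)⁻¹ + ((n : ℝ) + 1)⁻¹ * ‖e₁‖ := by
        rw [norm_smul, Real.norm_of_nonneg hpos.le]
        exact add_le_add_left (h1 n).le _
    _ = _ := by ring

lemma isGLB_norm_b2Star_sub {a b c d h : ℝ} (hcd : c < d) (hh : 0 < h) (e : L2 a b Plane) :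
    IsGLB ((fun φ => ‖b2Star a b c d hh φ - e‖) '' W12Zero c d) 0 := by
  obtain ⟨φ, hφ, hlim⟩ := exists_seq_tendsto_b2Star hcd hh e
  refine isGLB_of_mem_closure ?_ (mem_closure_of_tendsto hlim
    (Eventually.of_forall fun n => mem_image_of_mem _ (hφ n)))
  rintro _ ⟨ψ, -, rfl⟩
  exact norm_nonneg _

end MomentRecovery

theorem lemma4p4 (a b c d h : ℝ) (hab : a < b) (hcd : c < d) (hh : 0 < h) :
    -- density of the image
    Dense (MomentRecovery.b2Star a b c d hh '' MomentRecovery.W12Zero c d) ∧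
    -- without the norm constraint the infimum is zero for all data
    (∀ e : MomentRecovery.L2 a b MomentRecovery.Plane,
      IsGLB ((fun φ => ‖MomentRecovery.b2Star a b c d hh φ - e‖) '' MomentRecovery.W12Zero c d) 0) ∧
    -- there are data outside the image
    (∃ e : MomentRecovery.L2 a b MomentRecovery.Plane,
      e ∉ MomentRecovery.b2Star a b c d hh '' MomentRecovery.W12Zero c d) ∧
    -- for such data there is no minimizer, and all minimizing sequences diverge
    (∀ e : MomentRecovery.L2 a b MomentRecovery.Plane,
      e ∉ MomentRecovery.b2Star a b c d hh '' MomentRecovery.W12Zero c d →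
      (¬ ∃ φ₀ ∈ MomentRecovery.W12Zero c d,
        IsMinOn (fun φ => ‖MomentRecovery.b2Star a b c d hh φ - e‖)
          (MomentRecovery.W12Zero c d) φ₀) ∧
      ∀ φ : ℕ → MomentRecovery.L2 c d ℝ, (∀ n, φ n ∈ MomentRecovery.W12Zero c d) →
        Tendsto (fun n => ‖MomentRecovery.b2Star a b c d hh (φ n) - e‖) atTop (𝓝 0) →
        Tendsto (fun n => MomentRecovery.normW (φ n)) atTop atTop) ∧
    -- for all data some minimizing sequence diverges
    (∀ e : MomentRecovery.L2 a b MomentRecovery.Plane,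
      ∃ φ : ℕ → MomentRecovery.L2 c d ℝ, (∀ n, φ n ∈ MomentRecovery.W12Zero c d) ∧
        Tendsto (fun n => ‖MomentRecovery.b2Star a b c d hh (φ n) - e‖) atTop (𝓝 0) ∧
        Tendsto (fun n => MomentRecovery.normW (φ n)) atTop atTop) := by
  refine ⟨MomentRecovery.dense_image_b2Star hcd hh, MomentRecovery.isGLB_norm_b2Star_sub hcd hh,
    ?_, fun e he => ⟨?_, fun φ hφ hlim => MomentRecovery.tendsto_normW_atTop hcd hh he hφ hlim⟩,
    MomentRecovery.exists_seq_tendsto_b2Star_normW_atTop hab hcd hh⟩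
  · obtain ⟨e, he⟩ := MomentRecovery.exists_notMem_range_b2Star c d hab hh
    exact ⟨e, fun ⟨φ, _, hφ⟩ => he φ hφ⟩
  · rintro ⟨φ₀, hφ₀, hmin⟩
    have h0 : ‖MomentRecovery.b2Star a b c d hh φ₀ - e‖ ≤ 0 :=
      (MomentRecovery.isGLB_norm_b2Star_sub hcd hh e).2 (by
        rintro _ ⟨ψ, hψ, rfl⟩
        exact hmin hψ)
    exact he ⟨φ₀, hφ₀, sub_eq_zero.1 (norm_le_zero_iff.1 h0)⟩
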